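/- **Setting.** For $a<b$ let $\mathrm S(a,b)=\{\zeta\in\mathbb C: a<\operatorname{Im}\zeta<b\}$. A *scattering function* is a bounded continuous function $S:\overline{\mathrm S(0,\pi)}\to\mathbb C$, analytic in $\mathrm S(0,\pi)$, with $\overline{S(\theta)}=S(\theta)^{-1}=S(\theta+i\pi)=S(-\theta)$ for $\theta\in\mathbb R$. Let $\mathcal S_{\rm lim}$ be the set of scattering functions which continue to a bounded analytic function on $\mathrm S(-\kappa,\pi+\kappa)$ for some $\kappa>0$ and for which $\lim_{\theta\to\infty}S(\theta)=:S(\infty)$ and $\lim_{\theta\to-\infty}S(\theta)$ exist. For $m\ge 0$ put $\omega^m_p=(p^2+m^2)^{1/2}$. For $m>0$ let $$S_m(p,q)=S\Big(\sinh^{-1}\frac{p\,\omega^m_q-q\,\omega^m_p}{m^2}\Big),$$ and let $S_0(p,q)$ be $S(\log p-\log q)$ if $p,q>0$, $S(\log(-q)-\log(-p))$ if $p,q<0$, $S(0)$ if $p=q=0$, and $S(\infty)$ otherwise. For $m\ge0$ let $\mathcal H_{m,1}=L^2(\mathbb R,dp/\omega^m_p)$, let $\mathcal H_{m,n}\subset\mathcal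 H_{m,1}^{\otimes n}$ be the closed subspace of all $\Psi_n$ with $$\Psi_n(p_1,\dots,p_n)=S_m(p_{j+1},p_j)\,\Psi_n(p_1,\dots,p_{j+1},p_j,\dots,p_n)\quad\text{a.e.},\qquad j=1,\dots,n-1,$$ let $P_n$ be the orthogonal projection onto it, $\mathcal H_m=\bigoplus_{n\ge0}\mathcal H_{m,n}$ with $\mathcal H_{m,0}=\mathbb C$, $\Omega_m=1\oplus0\oplus0\oplus\cdots$, and let $\mathcal D_m\subset\mathcal H_m$ be the subspace of vectors with finite particle number. For $\varphi\in\mathcal H_{m,1}$ define on $\mathcal D_m$ $$(z_m(\varphi)\Psi)_n(p_1,\dots,p_n)=\sqrt{n+1}\int\frac{dq}{\omega^m_q}\,\varphi(q)\Psi_{n+1}(q,p_1,\dots,p_n),\qquad (z_m^\dagger(\varphi)\Psi)_n=\sqrt n\,P_n(\varphi\otimes\Psi_{n-1}),$$ and $(U_m(j)\Psi)_n(p_1,\dots,p_n)=\overline{\Psi_n(p_n,\dots,p_1)}$. For a (complex-valued) Schwartz function $f\in\mathscr S(\mathbb R^2)$ let $$f^{m\pm}(p)=\frac1{2\pi}\int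 d^2x\,f(x)\,e^{\pm i(\omega^m_px_0-p\,x_1)},$$ which lies in $\mathcal H_{m,1}$ if $m>0$, or if $m=0$ and $f^{0\pm}(0)=0$. For such $f$ define $$\phi_m(f)=z_m^\dagger(f^{m+})+z_m(f^{m-}),\qquad \phi_m'(f)=U_m(j)\,\phi_m(f^j)\,U_m(j)^{-1},\quad f^j(x)=\overline{f(-x)},$$ as operators on $\mathcal D_m$, and for $\lambda>0$ let $f_\lambda(x)=\lambda^{-2}f(\lambda^{-1}x)$. **Proposition.** Let $m>0$, $S\in\mathcal S_{\rm lim}$, $n\ge 0$, and let $f_1,\dots,f_n\in\mathscr S(\mathbb R^2)$ satisfy $f_j^{0\pm}(0)=0$ for $j=1,\dots,n$. Then $$\lim_{\lambda\downarrow0}\langle\Omega_m,\phi_m(f_{1,\lambda})\cdots\phi_m(f_{n,\lambda})\Omega_m\rangle=\langle\Omega_0,\phi_0(f_1)\cdots\phi_0(f_n)\Omega_0\rangle,$$ and likewise $$\lim_{\lambda\downarrow0}\langle\Omega_m,\phi_m'(f_{1,\lambda})\cdots\phi_m'(f_{n,\lambda})\Omega_m\rangle=\langle\Omega_0,\phi_0'(f_1)\cdots\phi_0'(f_n)\Omega_0\rangle,$$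 where $\phi_0,\phi_0'$ are the massless fields built from the same $S$. -/

import Mathlib

open MeasureTheory Filter Topology
open scoped ComplexConjugate ENNReal SchwartzMap FourierTransform

namespace FactorizingModel

noncomputable section

/-- The closed strip `{ζ : a ≤ Im ζ ≤ b}`. -/
def closedStrip (a b : ℝ) : Set ℂ := {ζ | a ≤ ζ.im ∧ ζ.im ≤ b}

/-- The open strip `{ζ : a < Im ζ < b}`. -/
def openStrip (a b : ℝ) : Set ℂ := {ζ | a < ζ.im ∧ ζ.im < b}

/-- Scattering functions on the closed strip `0 ≤ Im ζ ≤ π`; values of `S` outside this strip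
play no role. -/
structure IsScatteringFunction (S : ℂ → ℂ) : Prop where
  bounded : ∃ C : ℝ, ∀ ζ ∈ closedStrip 0 Real.pi, ‖S ζ‖ ≤ C
  continuousOn : ContinuousOn S (closedStrip 0 Real.pi)
  analytic : DifferentiableOn ℂ S (openStrip 0 Real.pi)
  ne_zero : ∀ θ : ℝ, S θ ≠ 0
  conj_eq_inv : ∀ θ : ℝ, conj (S θ) = (S θ)⁻¹
  inv_eq_crossing : ∀ θ : ℝ, (S θ)⁻¹ = S (θ + Complex.I * Real.pi)
  crossing_eq_neg : ∀ θ : ℝ, S (θ + Complex.I * Real.pi) = S (-θ)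

/-- Regular scattering functions: `S` continues to a bounded analytic function on a strip
`-κ < Im ζ < π + κ` with `κ > 0`. -/
structure IsRegularScatteringFunction (S : ℂ → ℂ) : Prop extends IsScatteringFunction S where
  regular : ∃ κ : ℝ, 0 < κ ∧ ∃ T : ℂ → ℂ,
    Set.EqOn T S (closedStrip 0 Real.pi) ∧
    DifferentiableOn ℂ T (openStrip (-κ) (Real.pi + κ)) ∧
    ∃ C : ℝ, ∀ ζ ∈ openStrip (-κ) (Real.pi + κ), ‖T ζ‖ ≤ C

/-- Scattering functions with limit. -/
structure IsScatteringFunctionWithLimit (S : ℂ → ℂ) : Prop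
    extends IsRegularScatteringFunction S where
  limit_atTop : ∃ a : ℂ, Tendsto (fun θ : ℝ => S θ) atTop (𝓝 a)
  limit_atBot : ∃ b : ℂ, Tendsto (fun θ : ℝ => S θ) atBot (𝓝 b)

/-- The energy `ω_p^m = (p² + m²)^{1/2}`. -/
def energy (m p : ℝ) : ℝ := Real.sqrt (p ^ 2 + m ^ 2)

/-- `S_m(p, q)` for `m > 0`. -/
def massiveKernel (S : ℂ → ℂ) (m p q : ℝ) : ℂ :=
  S (Real.arsinh ((p * energy m q - q * energy m p) / m ^ 2))

/-- `S(∞) = lim_{θ → ∞} S(θ)`. -/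
def limitValue (S : ℂ → ℂ) : ℂ := limUnder atTop (fun θ : ℝ => S θ)

open Classical in
/-- The massless function `S_0(p, q)`. -/
def masslessKernel (S : ℂ → ℂ) (p q : ℝ) : ℂ :=
  if 0 < p ∧ 0 < q then S ((Real.log p - Real.log q : ℝ) : ℂ)
  else if p < 0 ∧ q < 0 then S ((Real.log (-q) - Real.log (-p) : ℝ) : ℂ)
  else if p = 0 ∧ q = 0 then S 0
  else limitValue S

open Classical in
/-- `S_m(p, q)` for `m ≥ 0`. -/
def kernel (S : ℂ → ℂ) (m : ℝ) : ℝ → ℝ → ℂ :=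
  if m = 0 then masslessKernel S else massiveKernel S m

theorem kernel_unitary {S : ℂ → ℂ} (hS : IsScatteringFunctionWithLimit S) (m p q : ℝ) :
    kernel S m p q * conj (kernel S m p q) = 1 := by
  have h : ∀ θ : ℝ, S θ * conj (S θ) = 1 := fun θ => by
    rw [hS.conj_eq_inv, mul_inv_cancel₀ (hS.ne_zero θ)]
  have hlim : limitValue S * conj (limitValue S) = 1 := by
    have ht : Tendsto (fun θ : ℝ => S θ) atTop (𝓝 (limitValue S)) :=
      tendsto_nhds_limUnder hS.limit_atTop
    have h2 := ht.mul ((Complex.continuous_conj.tendsto _).comp ht)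
    refine tendsto_nhds_unique h2 ?_
    refine tendsto_const_nhds.congr fun θ => ?_
    exact (h θ).symm
  rw [kernel]
  split_ifs
  · rw [masslessKernel]
    split_ifs
    · exact h _
    · exact h _
    · simpa using h 0
    · exact hlim
  · exact h _

/-- The measure `dp / ω_p^m` on momentum space. -/
def momentumMeasure (m : ℝ) : Measure ℝ :=
  volume.withDensity fun p => ENNReal.ofReal (energy m p)⁻¹

instance (m : ℝ) : SigmaFinite (momentumMeasure m) := by
  unfold momentumMeasure; infer_instance

/-- Two-dimensional Minkowski space as a vector space, with coordinates `x 0` (time) and `x 1`. -/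
abbrev Spacetime : Type := EuclideanSpace ℝ (Fin 2)

/-- `f^{m±}(p) = (2π)⁻¹ ∫ f(x) exp(± i (ω_p^m x₀ - p x₁)) d²x`, with `ε = ± 1` the sign. -/
def massShell (ε m : ℝ) (f : 𝓢(Spacetime, ℂ)) (p : ℝ) : ℂ :=
  (1 / (2 * Real.pi) : ℂ) *
    ∫ x : Spacetime, f x * Complex.exp (ε * Complex.I * (energy m p * x 0 - p * x 1 : ℝ))

/-- The point at which the Fourier transform is evaluated in `massShell`. -/
def shellPoint (ε m p : ℝ) : Spacetime :=
  !₂[-(ε * energy m p / (2 * Real.pi)), ε * p / (2 * Real.pi)]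

theorem massShell_eq (ε m : ℝ) (f : 𝓢(Spacetime, ℂ)) (p : ℝ) :
    massShell ε m f p = (1 / (2 * Real.pi) : ℂ) * 𝓕 f (shellPoint ε m p) := by
  rw [massShell, SchwartzMap.fourier_coe, Real.fourier_eq']
  congr 2
  funext x
  rw [smul_eq_mul, mul_comm]
  congr 2
  have : inner ℝ x (shellPoint ε m p)
      = -(ε * (energy m p * x 0 - p * x 1)) / (2 * Real.pi) := by
    simp [shellPoint, PiLp.inner_apply, Fin.sum_univ_two]
    ring
  rw [this]
  have hpi : (Real.pi : ℂ) ≠ 0 := by exact_mod_cast Real.pi_ne_zero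
  push_cast
  field_simp

theorem continuous_shellPoint (ε m : ℝ) : Continuous (shellPoint ε m) := by
  unfold shellPoint energy
  fun_prop

theorem continuous_massShell (ε m : ℝ) (f : 𝓢(Spacetime, ℂ)) : Continuous (massShell ε m f) := by
  rw [funext (massShell_eq ε m f)]
  exact continuous_const.mul ((𝓕 f).continuous.comp (continuous_shellPoint ε m))

theorem massShell_decay {ε : ℝ} (hε : ε ^ 2 = 1) (m : ℝ) (f : 𝓢(Spacetime, ℂ)) :
    ∃ C : ℝ, ∀ p, ‖massShell ε m f p‖ ≤ C * (1 + p ^ 2)⁻¹ := by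
  obtain ⟨A, hA0, hA⟩ := (𝓕 f).decay 0 0
  obtain ⟨B, hB0, hB⟩ := (𝓕 f).decay 2 0
  refine ⟨A + 4 * Real.pi ^ 2 * B, fun p => ?_⟩
  have h1 := hA (shellPoint ε m p)
  have h2 := hB (shellPoint ε m p)
  simp only [norm_iteratedFDeriv_zero, pow_zero, one_mul] at h1 h2
  have hn : p ^ 2 ≤ 4 * Real.pi ^ 2 * ‖shellPoint ε m p‖ ^ 2 := by
    rw [EuclideanSpace.norm_sq_eq]
    simp only [shellPoint, Fin.sum_univ_two, Real.norm_eq_abs, sq_abs]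
    have : 4 * Real.pi ^ 2 * ((-(ε * energy m p / (2 * Real.pi))) ^ 2 +
        (ε * p / (2 * Real.pi)) ^ 2) = ε ^ 2 * (energy m p ^ 2 + p ^ 2) := by
      field_simp
      ring
    simp only [Matrix.cons_val_zero, Matrix.cons_val_one]
    rw [this, hε]
    nlinarith [sq_nonneg (energy m p)]
  rw [massShell_eq, norm_mul, ← div_eq_mul_inv, le_div_iff₀ (by positivity)]
  have hc : ‖(1 / (2 * Real.pi) : ℂ)‖ ≤ 1 := by
    have : (1 / (2 * Real.pi) : ℂ) = ((1 / (2 * Real.pi) : ℝ) : ℂ) := by push_cast; rfl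
    rw [this, Complex.norm_real, Real.norm_of_nonneg (by positivity)]
    rw [div_le_one (by positivity)]
    linarith [Real.pi_gt_three]
  have hg := norm_nonneg (𝓕 f (shellPoint ε m p))
  calc ‖(1 / (2 * Real.pi) : ℂ)‖ * ‖𝓕 f (shellPoint ε m p)‖ * (1 + p ^ 2)
      ≤ 1 * ‖𝓕 f (shellPoint ε m p)‖ *
        (1 + 4 * Real.pi ^ 2 * ‖shellPoint ε m p‖ ^ 2) := by gcongr
    _ = ‖𝓕 f (shellPoint ε m p)‖ +
        4 * Real.pi ^ 2 * (‖shellPoint ε m p‖ ^ 2 * ‖𝓕 f (shellPoint ε m p)‖) := by ring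
    _ ≤ _ := by gcongr

theorem memLp_massShell_of_bound {ε m : ℝ} (f : 𝓢(Spacetime, ℂ)) (C : ℝ)
    (h : ∀ p, (energy m p)⁻¹ * ‖massShell ε m f p‖ ^ 2 ≤ C * (1 + p ^ 2)⁻¹) :
    MemLp (massShell ε m f) 2 (momentumMeasure m) := by
  have hω : Continuous (energy m) := by unfold energy; fun_prop
  have hωm : Measurable fun p => (energy m p)⁻¹ := hω.measurable.inv
  have hω0 : ∀ p, 0 ≤ energy m p := fun p => Real.sqrt_nonneg _
  have hF := continuous_massShell ε m f
  rw [memLp_two_iff_integrable_sq_norm hF.aestronglyMeasurable, momentumMeasure,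
    integrable_withDensity_iff_integrable_smul' (by fun_prop) (by simp)]
  refine (integrable_inv_one_add_sq.const_mul C).mono' ?_ ?_
  · refine Measurable.aestronglyMeasurable ?_
    have := hF.measurable
    fun_prop
  · refine Eventually.of_forall fun p => ?_
    rw [ENNReal.toReal_ofReal (inv_nonneg.2 (hω0 p)), smul_eq_mul,
      Real.norm_of_nonneg (mul_nonneg (inv_nonneg.2 (hω0 p)) (by positivity))]
    exact h p

/-- `f^{m±} ∈ L²(ℝ, dp/ω_p^m)` for `m > 0`. -/
theorem memLp_massShell_of_pos {ε m : ℝ} (hε : ε ^ 2 = 1) (hm : 0 < m) (f : 𝓢(Spacetime, ℂ)) :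
    MemLp (massShell ε m f) 2 (momentumMeasure m) := by
  obtain ⟨C, hC⟩ := massShell_decay hε m f
  have hC0 : 0 ≤ C := by simpa using (norm_nonneg _).trans (hC 0)
  refine memLp_massShell_of_bound f (m⁻¹ * C ^ 2) fun p => ?_
  have h1 : m ≤ energy m p := Real.le_sqrt_of_sq_le (by nlinarith [sq_nonneg p])
  have h2 : (1 + p ^ 2)⁻¹ ≤ (1 : ℝ) := inv_le_one_of_one_le₀ (by nlinarith [sq_nonneg p])
  calc (energy m p)⁻¹ * ‖massShell ε m f p‖ ^ 2
      ≤ m⁻¹ * (C * (1 + p ^ 2)⁻¹) ^ 2 := by gcongr; exact hC p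
    _ = m⁻¹ * C ^ 2 * ((1 + p ^ 2)⁻¹ * (1 + p ^ 2)⁻¹) := by ring
    _ ≤ m⁻¹ * C ^ 2 * ((1 + p ^ 2)⁻¹ * 1) := by gcongr
    _ = _ := by ring

/-- `f^{0±} ∈ L²(ℝ, dp/|p|)` if `f^{0±}(0) = 0`. -/
theorem memLp_massShell_zero {ε : ℝ} (hε : ε ^ 2 = 1) (f : 𝓢(Spacetime, ℂ))
    (hf : massShell ε 0 f 0 = 0) :
    MemLp (massShell ε 0 f) 2 (momentumMeasure 0) := by
  obtain ⟨C, hC⟩ := massShell_decay hε 0 f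
  obtain ⟨B, hB0, hB⟩ := (𝓕 f).decay 0 1
  have hω : ∀ p, energy 0 p = |p| := fun p => by simp [energy, Real.sqrt_sq_eq_abs]
  have hlip : ∀ p, ‖massShell ε 0 f p‖ ≤ B * |p| := by
    intro p
    have h0 : 𝓕 f (shellPoint ε 0 0) = 0 := by
      rw [massShell_eq] at hf
      have hpi : (Real.pi : ℂ) ≠ 0 := by exact_mod_cast Real.pi_ne_zero
      simpa [hpi] using hf
    have h1 : ‖𝓕 f (shellPoint ε 0 p) - 𝓕 f (shellPoint ε 0 0)‖
        ≤ B * ‖shellPoint ε 0 p - shellPoint ε 0 0‖ :=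
      convex_univ.norm_image_sub_le_of_norm_fderiv_le (𝕜 := ℝ)
        (fun x _ => (𝓕 f).differentiableAt)
        (fun x _ => by simpa [norm_iteratedFDeriv_one] using hB x) (Set.mem_univ _)
        (Set.mem_univ _)
    have h2 : ‖shellPoint ε 0 p - shellPoint ε 0 0‖ ≤ |p| := by
      refine abs_le_of_sq_le_sq' ?_ (abs_nonneg p) |>.2
      rw [EuclideanSpace.norm_sq_eq]
      simp only [shellPoint, hω, Fin.sum_univ_two, Real.norm_eq_abs, sq_abs, PiLp.sub_apply,
        Matrix.cons_val_zero, Matrix.cons_val_one, abs_zero]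
      have : (-(ε * |p| / (2 * Real.pi)) - -(ε * 0 / (2 * Real.pi))) ^ 2 +
          (ε * p / (2 * Real.pi) - ε * 0 / (2 * Real.pi)) ^ 2
          = ε ^ 2 * (|p| ^ 2 + p ^ 2) / (4 * Real.pi ^ 2) := by
        field_simp; ring
      rw [this, hε, sq_abs, div_le_iff₀ (by positivity)]
      nlinarith [sq_nonneg p, Real.pi_gt_three, mul_nonneg (sq_nonneg p) (sq_nonneg Real.pi),
        mul_le_mul_of_nonneg_left (show (1 : ℝ) ≤ Real.pi ^ 2 by
          nlinarith [Real.pi_gt_three]) (sq_nonneg p)]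
    rw [h0, sub_zero] at h1
    have hc : ‖(1 / (2 * Real.pi) : ℂ)‖ ≤ 1 := by
      have : (1 / (2 * Real.pi) : ℂ) = ((1 / (2 * Real.pi) : ℝ) : ℂ) := by push_cast; rfl
      rw [this, Complex.norm_real, Real.norm_of_nonneg (by positivity)]
      rw [div_le_one (by positivity)]
      linarith [Real.pi_gt_three]
    rw [massShell_eq, norm_mul]
    calc _ ≤ 1 * (B * ‖shellPoint ε 0 p - shellPoint ε 0 0‖) := by gcongr
      _ ≤ 1 * (B * |p|) := by gcongr
      _ = _ := one_mul _
  refine memLp_massShell_of_bound f (B * C) fun p => ?_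
  rw [hω]
  rcases eq_or_ne p 0 with rfl | hp
  · have hC0 : 0 ≤ C := by simpa using (norm_nonneg _).trans (hC 0)
    simp; positivity
  · have hp' : 0 < |p| := abs_pos.2 hp
    calc |p|⁻¹ * ‖massShell ε 0 f p‖ ^ 2
        = |p|⁻¹ * (‖massShell ε 0 f p‖ * ‖massShell ε 0 f p‖) := by ring
      _ ≤ |p|⁻¹ * ((B * |p|) * (C * (1 + p ^ 2)⁻¹)) := by
        gcongr
        · exact hlip p
        · exact hC p
      _ = _ := by field_simp

open Classical in
/-- `f^{m±}` as an element of the one-particle space `L²(ℝ, dp/ω_p^m)`. The function lies in this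
space for `m > 0` (`memLp_massShell_of_pos`), and for `m = 0` if `f^{0±}(0) = 0`
(`memLp_massShell_zero`); otherwise the value is `0` by convention. -/
def oneParticle (ε m : ℝ) (f : 𝓢(Spacetime, ℂ)) : Lp ℂ 2 (momentumMeasure m) :=
  if h : MemLp (massShell ε m f) 2 (momentumMeasure m) then h.toLp _ else 0

open Classical in
/-- `f_l(x) = l⁻² f(l⁻¹ x)` for `l > 0` (and `0` otherwise). -/
def rescale (l : ℝ) (f : 𝓢(Spacetime, ℂ)) : 𝓢(Spacetime, ℂ) :=
  if h : 0 < l then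
    ((l : ℂ) ^ 2)⁻¹ • SchwartzMap.compCLMOfContinuousLinearEquiv ℂ
      (ContinuousLinearEquiv.smulLeft (R₁ := ℝ) (M₁ := Spacetime) (Units.mk0 l h.ne')⁻¹) f
  else 0

theorem rescale_apply {l : ℝ} (hl : 0 < l) (f : 𝓢(Spacetime, ℂ)) (x : Spacetime) :
    rescale l f x = ((l : ℂ) ^ 2)⁻¹ * f (l⁻¹ • x) := by
  rw [rescale, dif_pos hl]
  rfl

/-- `f^j(x) = conj f(-x)`. -/
def reflect (f : 𝓢(Spacetime, ℂ)) : 𝓢(Spacetime, ℂ) :=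
  SchwartzMap.postcompCLM (𝕜 := ℝ) (Complex.conjCLE : ℂ →L[ℝ] ℂ)
    (SchwartzMap.compCLMOfContinuousLinearEquiv ℝ (ContinuousLinearEquiv.neg ℝ) f)

theorem reflect_apply (f : 𝓢(Spacetime, ℂ)) (x : Spacetime) :
    reflect f x = conj (f (-x)) := rfl


/-- The `n`-fold tensor power of `L²(ℝ, μ)`, realized as `L²(ℝⁿ, μⁿ)`. For `n = 0` the base is a
one-point space of mass `1`, so this is `ℂ`. -/
abbrev TensorPower (μ : Measure ℝ) (n : ℕ) : Type :=
  Lp ℂ 2 (Measure.pi fun _ : Fin n => μ)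

theorem measurePreserving_perm (μ : Measure ℝ) [SigmaFinite μ] {n : ℕ} (σ : Equiv.Perm (Fin n)) :
    MeasurePreserving (fun p : Fin n → ℝ => p ∘ σ)
      (Measure.pi fun _ : Fin n => μ) (Measure.pi fun _ : Fin n => μ) := by
  have h := measurePreserving_piCongrLeft (α := fun _ : Fin n => ℝ) (fun _ : Fin n => μ) σ.symm
  have e : ⇑(MeasurableEquiv.piCongrLeft (fun _ : Fin n => ℝ) σ.symm)
      = fun p : Fin n → ℝ => p ∘ σ := by
    funext p i
    have := Equiv.piCongrLeft_apply_apply (fun _ : Fin n => ℝ) σ.symm p (σ i)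
    simpa [MeasurableEquiv.coe_piCongrLeft] using this
  rw [e] at h
  exact h

theorem measurePreserving_cons (μ : Measure ℝ) [SigmaFinite μ] (n : ℕ) :
    MeasurePreserving (fun z : (Fin n → ℝ) × ℝ => (Fin.cons z.2 z.1 : Fin (n + 1) → ℝ))
      ((Measure.pi fun _ : Fin n => μ).prod μ) (Measure.pi fun _ : Fin (n + 1) => μ) := by
  have h := (measurePreserving_piFinSuccAbove (fun _ : Fin (n + 1) => μ) 0).symm
  have h2 := h.comp (Measure.measurePreserving_swap (μ := Measure.pi fun _ : Fin n => μ) (ν := μ))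
  convert h2 using 1
  funext z
  exact (Fin.insertNth_zero' z.2 z.1).symm

theorem ae_ae_cons {μ : Measure ℝ} [SigmaFinite μ] {n : ℕ} {P : (Fin (n + 1) → ℝ) → Prop}
    (h : ∀ᵐ p ∂(Measure.pi fun _ : Fin (n + 1) => μ), P p) :
    ∀ᵐ p ∂(Measure.pi fun _ : Fin n => μ), ∀ᵐ q ∂μ, P (Fin.cons q p) :=
  Measure.ae_ae_of_ae_prod ((measurePreserving_cons μ n).quasiMeasurePreserving.ae h)

/-- `(D_n(τ_j)Ψ)(p_1, …, p_n) = s(p_{j+1}, p_j) Ψ(p_1, …, p_{j+1}, p_j, …, p_n)`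
(positions counted from `0`). -/
def exchange (s : ℝ → ℝ → ℂ) {n : ℕ} (j : ℕ) (hj : j + 1 < n)
    (Ψ : (Fin n → ℝ) → ℂ) (p : Fin n → ℝ) : ℂ :=
  s (p ⟨j + 1, hj⟩) (p ⟨j, Nat.lt_of_succ_lt hj⟩) *
    Ψ (p ∘ Equiv.swap (⟨j, Nat.lt_of_succ_lt hj⟩ : Fin n) ⟨j + 1, hj⟩)

/-- The subspace of vectors invariant under all `D_n(τ_j)`. -/
def nParticle (μ : Measure ℝ) [SigmaFinite μ] (s : ℝ → ℝ → ℂ) (n : ℕ) :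
    Submodule ℂ (TensorPower μ n) where
  carrier := {Ψ | ∀ (j : ℕ) (hj : j + 1 < n),
    exchange s j hj Ψ =ᵐ[Measure.pi fun _ : Fin n => μ] Ψ}
  zero_mem' := by
    intro j hj
    have h0 := Lp.coeFn_zero ℂ 2 (Measure.pi fun _ : Fin n => μ)
    filter_upwards [h0, (measurePreserving_perm μ _).quasiMeasurePreserving.ae h0] with p h1 h2
    rw [exchange, h2, h1]; simp
  add_mem' := by
    intro a b ha hb j hj
    have h0 := Lp.coeFn_add a b
    filter_upwards [h0, (measurePreserving_perm μ _).quasiMeasurePreserving.ae h0,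
      ha j hj, hb j hj] with p h1 h2 h3 h4
    rw [exchange, h2, h1, Pi.add_apply, Pi.add_apply, ← h3, ← h4, exchange, exchange]; ring
  smul_mem' := by
    intro c a ha j hj
    have h0 := Lp.coeFn_smul c a
    filter_upwards [h0, (measurePreserving_perm μ _).quasiMeasurePreserving.ae h0,
      ha j hj] with p h1 h2 h3
    rw [exchange, h2, h1, Pi.smul_apply, Pi.smul_apply, ← h3, exchange, smul_eq_mul, smul_eq_mul]
    ring

theorem isClosed_nParticle (μ : Measure ℝ) [SigmaFinite μ] (s : ℝ → ℝ → ℂ) (n : ℕ) :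
    IsClosed (nParticle μ s n : Set (TensorPower μ n)) := by
  refine IsSeqClosed.isClosed fun u Ψ hu hΨ j hj => ?_
  obtain ⟨k, -, hk⟩ := (tendstoInMeasure_of_tendsto_Lp hΨ).exists_seq_tendsto_ae
  filter_upwards [hk, (measurePreserving_perm μ _).quasiMeasurePreserving.ae hk,
    ae_all_iff.2 fun i => hu (k i) j hj] with p h1 h2 h3
  refine tendsto_nhds_unique ?_ h1
  have : (fun i => (u (k i) : (Fin n → ℝ) → ℂ) p) = fun i => exchange s j hj (u (k i)) p := by
    funext i; exact (h3 i).symm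
  rw [this]
  exact h2.const_mul _

instance (μ : Measure ℝ) [SigmaFinite μ] (s : ℝ → ℝ → ℂ) (n : ℕ) :
    CompleteSpace (nParticle μ s n) :=
  (isClosed_nParticle μ s n).completeSpace_coe

theorem memLp_tensor {μ : Measure ℝ} [SigmaFinite μ] {n : ℕ} (φ : Lp ℂ 2 μ)
    (Ψ : TensorPower μ n) :
    MemLp (fun p : Fin (n + 1) → ℝ => φ (p 0) * Ψ (Fin.tail p)) 2
      (Measure.pi fun _ : Fin (n + 1) => μ) := by
  have hφ := Lp.memLp φ
  have hΨ := Lp.memLp Ψ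
  have h1 : MemLp (fun z : ℝ × (Fin n → ℝ) => φ z.1 * Ψ z.2) 2
      (μ.prod (Measure.pi fun _ : Fin n => μ)) := by
    have hm : AEStronglyMeasurable (fun z : ℝ × (Fin n → ℝ) => φ z.1 * Ψ z.2)
        (μ.prod (Measure.pi fun _ : Fin n => μ)) := hφ.1.comp_fst.mul hΨ.1.comp_snd
    rw [memLp_two_iff_integrable_sq_norm hm]
    have := ((memLp_two_iff_integrable_sq_norm hφ.1).1 hφ).mul_prod
      ((memLp_two_iff_integrable_sq_norm hΨ.1).1 hΨ)
    simpa [mul_pow] using this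
  exact h1.comp_measurePreserving
    (measurePreserving_piFinSuccAbove (fun _ : Fin (n + 1) => μ) 0)

/-- `Ψ ↦ φ ⊗ Ψ`. -/
def tensor {μ : Measure ℝ} [SigmaFinite μ] (n : ℕ) (φ : Lp ℂ 2 μ) :
    TensorPower μ n →ₗ[ℂ] TensorPower μ (n + 1) where
  toFun Ψ := (memLp_tensor φ Ψ).toLp _
  map_add' a b := by
    rw [← MemLp.toLp_add]
    refine MemLp.toLp_congr _ _ ?_
    have hq : Measure.QuasiMeasurePreserving (fun p : Fin (n + 1) → ℝ => Fin.tail p)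
        (Measure.pi fun _ : Fin (n + 1) => μ) (Measure.pi fun _ : Fin n => μ) :=
      Measure.quasiMeasurePreserving_snd.comp
        (measurePreserving_piFinSuccAbove (fun _ : Fin (n + 1) => μ) 0).quasiMeasurePreserving
    filter_upwards [hq.ae (Lp.coeFn_add a b)] with p hp
    rw [hp]; simp [mul_add]
  map_smul' c a := by
    rw [RingHom.id_apply, ← MemLp.toLp_const_smul]
    refine MemLp.toLp_congr _ _ ?_
    have hq : Measure.QuasiMeasurePreserving (fun p : Fin (n + 1) → ℝ => Fin.tail p)
        (Measure.pi fun _ : Fin (n + 1) => μ) (Measure.pi fun _ : Fin n => μ) :=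
      Measure.quasiMeasurePreserving_snd.comp
        (measurePreserving_piFinSuccAbove (fun _ : Fin (n + 1) => μ) 0).quasiMeasurePreserving
    filter_upwards [hq.ae (Lp.coeFn_smul c a)] with p hp
    rw [hp]; simp [mul_left_comm]

/-- `Ψ ↦ √(n+1) P_{n+1}(φ ⊗ Ψ)`, with `P_{n+1}` the orthogonal projection onto the
invariant subspace. -/
def create {μ : Measure ℝ} [SigmaFinite μ] (s : ℝ → ℝ → ℂ) (n : ℕ) (φ : Lp ℂ 2 μ) :
    nParticle μ s n →ₗ[ℂ] nParticle μ s (n + 1) :=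
  ((Real.sqrt (n + 1) : ℝ) : ℂ) •
    ((nParticle μ s (n + 1)).orthogonalProjectionOnto.toLinearMap ∘ₗ
      tensor n φ ∘ₗ (nParticle μ s n).subtype)

theorem ae_memLp_cons {μ : Measure ℝ} [SigmaFinite μ] {n : ℕ} (Ψ : TensorPower μ (n + 1)) :
    ∀ᵐ p ∂(Measure.pi fun _ : Fin n => μ), MemLp (fun q => Ψ (Fin.cons q p)) 2 μ := by
  have h1 := (Lp.memLp Ψ).comp_measurePreserving (measurePreserving_cons μ n)
  have h2 := ((memLp_two_iff_integrable_sq_norm h1.1).1 h1).prod_right_ae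
  filter_upwards [h1.1.prodMk_left, h2] with p h3 h4
  exact (memLp_two_iff_integrable_sq_norm h3).2 h4

/-- `p ↦ √(n+1) ∫ φ(q) Ψ(q, p_1, …, p_n) dμ(q)`. -/
def annihilateFun {μ : Measure ℝ} {n : ℕ} (φ : ℝ → ℂ) (Ψ : (Fin (n + 1) → ℝ) → ℂ)
    (p : Fin n → ℝ) : ℂ :=
  ((Real.sqrt (n + 1) : ℝ) : ℂ) * ∫ q, φ q * Ψ (Fin.cons q p) ∂μ

theorem memLp_annihilate {μ : Measure ℝ} [SigmaFinite μ] {n : ℕ} (φ : Lp ℂ 2 μ)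
    (Ψ : TensorPower μ (n + 1)) :
    MemLp (annihilateFun (μ := μ) φ Ψ) 2 (Measure.pi fun _ : Fin n => μ) := by
  have h1 := (Lp.memLp Ψ).comp_measurePreserving (measurePreserving_cons μ n)
  have hφ := Lp.memLp φ
  have hm : AEStronglyMeasurable (fun p : Fin n → ℝ => ∫ q, φ q * Ψ (Fin.cons q p) ∂μ)
      (Measure.pi fun _ : Fin n => μ) :=
    AEStronglyMeasurable.integral_prod_right' (f := fun z : (Fin n → ℝ) × ℝ =>
      φ z.2 * Ψ (Fin.cons z.2 z.1)) (hφ.1.comp_snd.mul h1.1)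
  refine MemLp.const_mul ?_ _
  rw [memLp_two_iff_integrable_sq_norm hm]
  have h2 := ((memLp_two_iff_integrable_sq_norm h1.1).1 h1).integral_prod_left
  refine (h2.const_mul (∫ q, ‖φ q‖ ^ 2 ∂μ)).mono' (hm.norm.pow 2) ?_
  filter_upwards [ae_memLp_cons Ψ] with p hp
  have hcs := integral_mul_norm_le_Lp_mul_Lq (μ := μ) (p := 2) (q := 2) (f := φ)
    (g := fun q => Ψ (Fin.cons q p)) Real.HolderConjugate.two_two
    (by simpa using hφ) (by simpa using hp)
  have hle : ‖∫ q, φ q * Ψ (Fin.cons q p) ∂μ‖ ≤ ∫ q, ‖φ q‖ * ‖Ψ (Fin.cons q p)‖ ∂μ := by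
    refine (norm_integral_le_integral_norm _).trans (le_of_eq ?_)
    simp
  have hA : 0 ≤ ∫ q, ‖φ q‖ ^ 2 ∂μ := integral_nonneg fun _ => by positivity
  have hB : 0 ≤ ∫ q, ‖Ψ (Fin.cons q p)‖ ^ 2 ∂μ := integral_nonneg fun _ => by positivity
  have h3 := hle.trans hcs
  simp only [Real.rpow_two, ← Real.sqrt_eq_rpow] at h3
  rw [Real.norm_of_nonneg (by positivity)]
  calc ‖∫ q, φ q * Ψ (Fin.cons q p) ∂μ‖ ^ 2
      ≤ (√(∫ q, ‖φ q‖ ^ 2 ∂μ) * √(∫ q, ‖Ψ (Fin.cons q p)‖ ^ 2 ∂μ)) ^ 2 := by gcongr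
    _ = _ := by rw [mul_pow, Real.sq_sqrt hA, Real.sq_sqrt hB]; rfl

/-- The annihilation map on `L²(ℝ^{n+1}) → L²(ℝ^n)`. -/
def annihilateTensor {μ : Measure ℝ} [SigmaFinite μ] (n : ℕ) (φ : Lp ℂ 2 μ) :
    TensorPower μ (n + 1) →ₗ[ℂ] TensorPower μ n where
  toFun Ψ := (memLp_annihilate φ Ψ).toLp _
  map_add' a b := by
    rw [← MemLp.toLp_add]
    refine MemLp.toLp_congr _ _ ?_
    filter_upwards [ae_ae_cons (Lp.coeFn_add a b),
      ae_memLp_cons a, ae_memLp_cons b]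
      with p h1 h2 h3
    have i2 : Integrable (fun q => φ q * a (Fin.cons q p)) μ :=
      MemLp.integrable_mul (Lp.memLp φ) h2
    have i3 : Integrable (fun q => φ q * b (Fin.cons q p)) μ :=
      MemLp.integrable_mul (Lp.memLp φ) h3
    rw [Pi.add_apply, annihilateFun, annihilateFun, annihilateFun, ← mul_add,
      ← integral_add i2 i3]
    congr 1
    refine integral_congr_ae ?_
    filter_upwards [h1] with q hq
    rw [← mul_add]
    exact congrArg _ hq
  map_smul' c a := by
    rw [RingHom.id_apply, ← MemLp.toLp_const_smul]
    refine MemLp.toLp_congr _ _ ?_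
    filter_upwards [ae_ae_cons (Lp.coeFn_smul c a)] with p h1
    rw [Pi.smul_apply, annihilateFun, annihilateFun, smul_eq_mul, mul_left_comm c,
      ← integral_const_mul c]
    congr 1
    refine integral_congr_ae ?_
    filter_upwards [h1] with q hq
    rw [mul_left_comm]
    exact congrArg _ hq

theorem annihilate_mem {μ : Measure ℝ} [SigmaFinite μ] {s : ℝ → ℝ → ℂ} {n : ℕ} (φ : Lp ℂ 2 μ)
    (Ψ : nParticle μ s (n + 1)) :
    annihilateTensor n φ Ψ ∈ nParticle μ s n := by
  intro j hj
  have h0 := (memLp_annihilate φ (Ψ : TensorPower μ (n + 1))).coeFn_toLp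
  have h1 := ae_ae_cons (Ψ.2 (j + 1) (by omega))
  filter_upwards [h0, (measurePreserving_perm μ _).quasiMeasurePreserving.ae h0, h1]
    with p h2 h3 h4
  change exchange s j hj ((memLp_annihilate φ (Ψ : TensorPower μ (n + 1))).toLp _) p
    = (memLp_annihilate φ (Ψ : TensorPower μ (n + 1))).toLp _ p
  rw [exchange, h3, h2, annihilateFun, annihilateFun, mul_left_comm, ← integral_const_mul]
  congr 1
  refine integral_congr_ae ?_
  filter_upwards [h4] with q hq
  rw [← hq, exchange, mul_left_comm]
  congr 3
  funext i
  refine Fin.cases ?_ (fun i => ?_) i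
  · have : Equiv.swap (⟨j + 1, by omega⟩ : Fin (n + 1)) ⟨j + 1 + 1, by omega⟩ 0 = 0 :=
      Equiv.swap_apply_of_ne_of_ne (by simp [Fin.ext_iff]) (by simp [Fin.ext_iff])
    simp [this]
  · have : Equiv.swap (⟨j + 1, by omega⟩ : Fin (n + 1)) ⟨j + 1 + 1, by omega⟩ i.succ
        = (Equiv.swap (⟨j, by omega⟩ : Fin n) ⟨j + 1, by omega⟩ i).succ :=
      (Fin.succ_injective n).swap_apply ⟨j, by omega⟩ ⟨j + 1, by omega⟩ i
    simp [this]

/-- `(z(φ)Ψ)_n(p) = √(n+1) ∫ φ(q) Ψ_{n+1}(q, p) dμ(q)`. -/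
def annihilate {μ : Measure ℝ} [SigmaFinite μ] (s : ℝ → ℝ → ℂ) (n : ℕ) (φ : Lp ℂ 2 μ) :
    nParticle μ s (n + 1) →ₗ[ℂ] nParticle μ s n :=
  (annihilateTensor n φ).restrict fun Ψ hΨ => annihilate_mem φ ⟨Ψ, hΨ⟩

/-- The `s`-symmetric Fock space, the Hilbert sum of the `n`-particle spaces. -/
abbrev Fock (μ : Measure ℝ) [SigmaFinite μ] (s : ℝ → ℝ → ℂ) : Type :=
  lp (fun n => nParticle μ s n) 2

/-- Vectors of finite particle number. -/
def finiteParticle (μ : Measure ℝ) [SigmaFinite μ] (s : ℝ → ℝ → ℂ) :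
    Submodule ℂ (Fock μ s) where
  carrier := {Ψ | ∃ N : ℕ, ∀ n, N ≤ n → Ψ n = 0}
  zero_mem' := ⟨0, fun _ _ => rfl⟩
  add_mem' := by
    rintro a b ⟨N, hN⟩ ⟨M, hM⟩
    refine ⟨max N M, fun n hn => ?_⟩
    rw [lp.coeFn_add, Pi.add_apply, hN n (le_trans (le_max_left _ _) hn),
      hM n (le_trans (le_max_right _ _) hn), add_zero]
  smul_mem' := by
    rintro c a ⟨N, hN⟩
    refine ⟨N, fun n hn => ?_⟩
    rw [lp.coeFn_smul, Pi.smul_apply, hN n hn, smul_zero]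

theorem memlp_of_eventually_zero {μ : Measure ℝ} [SigmaFinite μ] {s : ℝ → ℝ → ℂ}
    (Ψ : ∀ n, nParticle μ s n) (N : ℕ) (h : ∀ n, N ≤ n → Ψ n = 0) : Memℓp Ψ 2 := by
  refine (memℓp_zero ?_).of_exponent_ge zero_le
  refine (Set.finite_lt_nat N).subset fun n hn => ?_
  by_contra hc
  exact hn (h n (not_lt.1 hc))

/-- A finite sequence of `n`-particle vectors as a vector of finite particle number. -/
def mkFinite {μ : Measure ℝ} [SigmaFinite μ] {s : ℝ → ℝ → ℂ}
    (Ψ : ∀ n, nParticle μ s n) (h : ∃ N : ℕ, ∀ n, N ≤ n → Ψ n = 0) : finiteParticle μ s :=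
  ⟨⟨Ψ, memlp_of_eventually_zero Ψ h.choose h.choose_spec⟩, h⟩

/-- `z†(φ)` on vectors of finite particle number: `(z†(φ)Ψ)_n = √n P_n(φ ⊗ Ψ_{n-1})`. -/
def creation {μ : Measure ℝ} [SigmaFinite μ] (s : ℝ → ℝ → ℂ) (φ : Lp ℂ 2 μ) :
    Module.End ℂ (finiteParticle μ s) where
  toFun Ψ := mkFinite
    (fun n => match n with
      | 0 => 0
      | k + 1 => create s k φ ((Ψ : Fock μ s) k))
    (by
      obtain ⟨N, hN⟩ := Ψ.2
      refine ⟨N + 1, fun n hn => ?_⟩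
      obtain ⟨k, rfl⟩ : ∃ k, n = k + 1 := ⟨n - 1, by omega⟩
      change create s k φ _ = 0
      rw [hN k (by omega), map_zero])
  map_add' a b := by
    refine Subtype.ext (Subtype.ext (funext fun n => ?_))
    cases n with
    | zero => exact (add_zero _).symm
    | succ k => exact map_add (create s k φ) _ _
  map_smul' c a := by
    refine Subtype.ext (Subtype.ext (funext fun n => ?_))
    cases n with
    | zero => exact (smul_zero c).symm
    | succ k => exact map_smul (create s k φ) _ _

/-- `z(φ)` on vectors of finite particle number:
`(z(φ)Ψ)_n(p) = √(n+1) ∫ φ(q) Ψ_{n+1}(q, p) dμ(q)`. -/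
def annihilation {μ : Measure ℝ} [SigmaFinite μ] (s : ℝ → ℝ → ℂ) (φ : Lp ℂ 2 μ) :
    Module.End ℂ (finiteParticle μ s) where
  toFun Ψ := mkFinite (fun n => annihilate s n φ ((Ψ : Fock μ s) (n + 1)))
    (by
      obtain ⟨N, hN⟩ := Ψ.2
      refine ⟨N, fun n hn => ?_⟩
      rw [hN (n + 1) (by omega), map_zero])
  map_add' a b :=
    Subtype.ext (Subtype.ext (funext fun n => map_add (annihilate s n φ) _ _))
  map_smul' c a :=
    Subtype.ext (Subtype.ext (funext fun n => map_smul (annihilate s n φ) _ _))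


theorem memLp_one (μ : Measure ℝ) [SigmaFinite μ] :
    MemLp (fun _ : Fin 0 → ℝ => (1 : ℂ)) 2 (Measure.pi fun _ : Fin 0 => μ) := by
  have : IsFiniteMeasure (Measure.pi fun _ : Fin 0 => μ) := by
    rw [Measure.pi_of_empty]; infer_instance
  exact memLp_const 1

/-- `Ω = 1 ⊕ 0 ⊕ 0 ⊕ …`. -/
def vacuum (μ : Measure ℝ) [SigmaFinite μ] (s : ℝ → ℝ → ℂ) : finiteParticle μ s :=
  mkFinite
    (fun n => match n with
      | 0 => ⟨(memLp_one μ).toLp _, fun _ hj => absurd hj (Nat.not_lt_zero _)⟩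
      | _ + 1 => 0)
    ⟨1, fun n hn => by
      obtain ⟨k, rfl⟩ : ∃ k, n = k + 1 := ⟨n - 1, by omega⟩
      rfl⟩

theorem memLp_reverse {μ : Measure ℝ} [SigmaFinite μ] {n : ℕ} (Ψ : TensorPower μ n) :
    MemLp (fun p : Fin n → ℝ => conj (Ψ (p ∘ Fin.revPerm))) 2
      (Measure.pi fun _ : Fin n => μ) :=
  ((Lp.memLp Ψ).comp_measurePreserving (measurePreserving_perm μ Fin.revPerm)).star

/-- `(p_1, …, p_n) ↦ conj Ψ(p_n, …, p_1)`. -/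
def reverseTensor {μ : Measure ℝ} [SigmaFinite μ] (n : ℕ) :
    TensorPower μ n →ₗ⋆[ℂ] TensorPower μ n where
  toFun Ψ := (memLp_reverse Ψ).toLp _
  map_add' a b := by
    rw [← MemLp.toLp_add]
    refine MemLp.toLp_congr _ _ ?_
    filter_upwards [(measurePreserving_perm μ Fin.revPerm).quasiMeasurePreserving.ae
      (Lp.coeFn_add a b)] with p hp
    rw [hp]; simp
  map_smul' c a := by
    rw [← MemLp.toLp_const_smul]
    refine MemLp.toLp_congr _ _ ?_
    filter_upwards [(measurePreserving_perm μ Fin.revPerm).quasiMeasurePreserving.ae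
      (Lp.coeFn_smul c a)] with p hp
    rw [hp]; simp

theorem reverse_mem {μ : Measure ℝ} [SigmaFinite μ] {s : ℝ → ℝ → ℂ}
    (hs : ∀ p q, s p q * conj (s p q) = 1) {n : ℕ} (Ψ : nParticle μ s n) :
    reverseTensor n (Ψ : TensorPower μ n) ∈ nParticle μ s n := by
  intro j hj
  have h0 := (memLp_reverse (Ψ : TensorPower μ n)).coeFn_toLp
  have h1 := (measurePreserving_perm μ
    (Equiv.swap (⟨j, Nat.lt_of_succ_lt hj⟩ : Fin n) ⟨j + 1, hj⟩)).quasiMeasurePreserving.ae h0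
  have hk : n - (j + 2) + 1 < n := by omega
  have h2 := (measurePreserving_perm μ
    (Equiv.swap (⟨j, Nat.lt_of_succ_lt hj⟩ : Fin n) ⟨j + 1, hj⟩)).quasiMeasurePreserving.ae
    ((measurePreserving_perm μ Fin.revPerm).quasiMeasurePreserving.ae (Ψ.2 (n - (j + 2)) hk))
  filter_upwards [h0, h1, h2] with p h4 h5 h6
  have r0 : Fin.rev (⟨n - (j + 2), Nat.lt_of_succ_lt hk⟩ : Fin n) = ⟨j + 1, hj⟩ := by
    ext; simp [Fin.rev]; omega
  have r1 : Fin.rev (⟨n - (j + 2) + 1, hk⟩ : Fin n) = ⟨j, Nat.lt_of_succ_lt hj⟩ := by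
    ext; simp [Fin.rev]; omega
  have e : ((p ∘ Equiv.swap (⟨j, Nat.lt_of_succ_lt hj⟩ : Fin n) ⟨j + 1, hj⟩) ∘ Fin.revPerm) ∘
      Equiv.swap (⟨n - (j + 2), Nat.lt_of_succ_lt hk⟩ : Fin n) ⟨n - (j + 2) + 1, hk⟩
      = p ∘ Fin.revPerm := by
    funext i
    have h7 := Fin.rev_injective.swap_apply (⟨n - (j + 2), Nat.lt_of_succ_lt hk⟩ : Fin n)
      ⟨n - (j + 2) + 1, hk⟩ i
    rw [r0, r1, Equiv.swap_comm] at h7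
    simp only [Function.comp_apply, Fin.revPerm_apply, ← h7, Equiv.swap_apply_self]
  rw [exchange, e] at h6
  simp only [Function.comp_apply, Fin.revPerm_apply, r0, r1, Equiv.swap_apply_left,
    Equiv.swap_apply_right] at h6
  change exchange s j hj ((memLp_reverse (Ψ : TensorPower μ n)).toLp _) p
    = (memLp_reverse (Ψ : TensorPower μ n)).toLp _ p
  rw [exchange, h5, h4, ← h6, map_mul, ← mul_assoc, hs, one_mul]

theorem reverse_reverse {μ : Measure ℝ} [SigmaFinite μ] {n : ℕ} (Ψ : TensorPower μ n) :
    reverseTensor n (reverseTensor n Ψ) = Ψ := by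
  refine Lp.ext ?_
  have h0 := (memLp_reverse Ψ).coeFn_toLp
  filter_upwards [(memLp_reverse (reverseTensor n Ψ)).coeFn_toLp,
    (measurePreserving_perm μ Fin.revPerm).quasiMeasurePreserving.ae h0] with p h1 h2
  refine h1.trans ?_
  change conj ((memLp_reverse Ψ).toLp _ (p ∘ Fin.revPerm)) = _
  rw [h2, Complex.conj_conj]
  congr 1
  funext i
  simp

/-- The antilinear involution `(U(j)Ψ)_n(p_1, …, p_n) = conj Ψ_n(p_n, …, p_1)`
on the vectors of finite particle number. -/
def reflection {μ : Measure ℝ} [SigmaFinite μ] {s : ℝ → ℝ → ℂ}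
    (hs : ∀ p q, s p q * conj (s p q) = 1) :
    finiteParticle μ s ≃ₗ⋆[ℂ] finiteParticle μ s :=
  LinearEquiv.ofInvolutive
    { toFun := fun Ψ => mkFinite
        (fun n => ⟨reverseTensor n ((Ψ : Fock μ s) n).1, reverse_mem hs ((Ψ : Fock μ s) n)⟩)
        (by
          obtain ⟨N, hN⟩ := Ψ.2
          refine ⟨N, fun n hn => Subtype.ext ?_⟩
          change reverseTensor n ((Ψ : Fock μ s) n).1 = 0
          rw [hN n hn]
          exact map_zero _)
      map_add' := fun a b => Subtype.ext (Subtype.ext (funext fun n =>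
        Subtype.ext (map_add (reverseTensor n) _ _)))
      map_smul' := fun c a => Subtype.ext (Subtype.ext (funext fun n =>
        Subtype.ext (map_smulₛₗ (reverseTensor n) c _))) }
    (fun Ψ => Subtype.ext (Subtype.ext (funext fun n =>
      Subtype.ext (reverse_reverse ((Ψ : Fock μ s) n).1))))

/-- The field `φ_m(f) = z†_m(f^{m+}) + z_m(f^{m-})` on vectors of finite particle number. -/
def field (S : ℂ → ℂ) (m : ℝ) (f : 𝓢(Spacetime, ℂ)) :
    Module.End ℂ (finiteParticle (momentumMeasure m) (kernel S m)) :=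
  creation (kernel S m) (oneParticle 1 m f) + annihilation (kernel S m) (oneParticle (-1) m f)

/-- The reflected field `φ_m'(f) = U_m(j) φ_m(f^j) U_m(j)⁻¹`. -/
def reflectedField {S : ℂ → ℂ} (hS : IsScatteringFunctionWithLimit S) (m : ℝ)
    (f : 𝓢(Spacetime, ℂ)) :
    Module.End ℂ (finiteParticle (momentumMeasure m) (kernel S m)) :=
  (reflection (kernel_unitary hS m)).toLinearMap ∘ₛₗ field S m (reflect f) ∘ₛₗ
    (reflection (kernel_unitary hS m)).symm.toLinearMap

/-- `⟨Ω, A_1 ⋯ A_n Ω⟩`. -/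
def vacuumExpectation {μ : Measure ℝ} [SigmaFinite μ] {s : ℝ → ℝ → ℂ} {n : ℕ}
    (A : Fin n → Module.End ℂ (finiteParticle μ s)) : ℂ :=
  inner ℂ (vacuum μ s : Fock μ s) ((List.ofFn A).prod (vacuum μ s) : Fock μ s)

/-- `⟨Ω_m, φ_m(f_{1,l}) ⋯ φ_m(f_{n,l}) Ω_m⟩`. -/
def nPoint (S : ℂ → ℂ) (m l : ℝ) {n : ℕ} (f : Fin n → 𝓢(Spacetime, ℂ)) : ℂ :=
  vacuumExpectation fun j => field S m (rescale l (f j))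

/-- `⟨Ω_m, φ_m'(f_{1,l}) ⋯ φ_m'(f_{n,l}) Ω_m⟩`. -/
def reflectedNPoint {S : ℂ → ℂ} (hS : IsScatteringFunctionWithLimit S) (m l : ℝ) {n : ℕ}
    (f : Fin n → 𝓢(Spacetime, ℂ)) : ℂ :=
  vacuumExpectation fun j => reflectedField hS m (rescale l (f j))

end

end FactorizingModel

namespace FactorizingModel

noncomputable section

/-!
On `S_m`-symmetric vectors, `√(n+1) P_{n+1} (φ ⊗ Ψ)` is an explicit average over the `n + 1`
positions at which the variable of `φ` can be inserted. The vectors `φ_m(f_1) ⋯ φ_m(f_k) Ω_m`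
therefore have representatives which are everywhere defined functions, given by the same formulas
for all masses `m ≥ 0`. Substituting `p ↦ l p` in these formulas shows that rescaling the test
functions by `l` amounts to replacing the mass `m` by `l m`, so that only the limit `m ↓ 0` at fixed
test functions has to be taken.

The kernels `S_m(p, q)` converge for nonzero momenta: `sinh⁻¹ (p / m)` diverges like
`± (log |p| - log (m / 2))`, so the argument of `S` tends to a difference of logarithms if `p` and
`q` have the same sign and to `± ∞` otherwise. In the latter case both signs give the same limit,
because Cauchy's theorem in the strip forces `S(∞)` to be real. Finally, `f^{0±}(0) = 0` bounds
`f^{m±}` by a constant times `(ω_p^m / (1 + p²))^{1/2}`, uniformly in `m`. This makes the integrand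
of each annihilation operator integrable uniformly in `m`, and dominated convergence applies.

Conjugation by the reflection `J`, which is antiunitary and fixes the vacuum, turns every vacuum
expectation value into its complex conjugate, so the statement on `φ'` follows from the one on `φ`.
-/

/-! ### Moving one variable past the others -/

section Combinatorics

variable {s : ℝ → ℝ → ℂ} {n : ℕ}

/-- The factor `∏_{l < k} s(p_k, p_l)` that an `s`-symmetric function acquires when its `k`-th
variable is moved to the front. -/
def exchangeFactor (s : ℝ → ℝ → ℂ) {n : ℕ} (k : Fin n) (p : Fin n → ℝ) : ℂ :=
  ∏ l ∈ Finset.Iio k, s (p k) (p l)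

theorem swap_castSucc_succ_succAbove (i j : Fin n) :
    Equiv.swap i.castSucc i.succ (i.castSucc.succAbove j) = i.succ.succAbove j := by
  simp only [Fin.succAbove, Equiv.swap_apply_def, Fin.ext_iff, Fin.lt_def]
  split_ifs <;> simp_all <;> omega

theorem swap_castSucc_succ_cycleRange_symm (i : Fin n) (j : Fin (n + 1)) :
    Equiv.swap i.castSucc i.succ (i.castSucc.cycleRange.symm j) = i.succ.cycleRange.symm j := by
  cases j using Fin.cases with
  | zero => rw [Fin.cycleRange_symm_zero, Fin.cycleRange_symm_zero, Equiv.swap_apply_left]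
  | succ j =>
    rw [Fin.cycleRange_symm_succ, Fin.cycleRange_symm_succ, swap_castSucc_succ_succAbove]

theorem castSucc_removeNth_comp_swap {α : Type*} (i : Fin n) (p : Fin (n + 1) → α) :
    i.castSucc.removeNth (p ∘ Equiv.swap i.castSucc i.succ) = i.succ.removeNth p :=
  funext fun j => congrArg p (swap_castSucc_succ_succAbove i j)

theorem tail_comp_cycleRange_symm {α : Type*} (k : Fin (n + 1)) (p : Fin (n + 1) → α) :
    Fin.tail (p ∘ k.cycleRange.symm) = k.removeNth p :=
  funext fun i => congrArg p (k.cycleRange_symm_succ i)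

theorem exists_succAbove_eq_castSucc_and_succ {i : Fin n} {k : Fin (n + 1)}
    (h₀ : k ≠ i.castSucc) (h₁ : k ≠ i.succ) :
    ∃ (j : ℕ) (hj : j + 1 < n), k.succAbove ⟨j, Nat.lt_of_succ_lt hj⟩ = i.castSucc ∧
      k.succAbove ⟨j + 1, hj⟩ = i.succ := by
  rw [Ne, Fin.ext_iff, Fin.val_castSucc] at h₀
  rw [Ne, Fin.ext_iff, Fin.val_succ] at h₁
  rcases lt_or_gt_of_ne h₀ with h | h
  · refine ⟨i - 1, by omega, ?_, ?_⟩ <;>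
    · simp only [Fin.succAbove, Fin.ext_iff, Fin.lt_def]
      split_ifs <;> simp_all <;> omega
  · refine ⟨i, by omega, ?_, ?_⟩ <;>
    · simp only [Fin.succAbove, Fin.ext_iff, Fin.lt_def]
      split_ifs <;> simp_all <;> omega

theorem exchangeFactor_zero (s : ℝ → ℝ → ℂ) (p : Fin (n + 1) → ℝ) :
    exchangeFactor s 0 p = 1 :=
  Finset.prod_eq_one fun _ hl => absurd (Finset.mem_Iio.1 hl) (Fin.not_lt_zero _)

theorem exchangeFactor_succ (s : ℝ → ℝ → ℂ) (i : Fin n) (p : Fin (n + 1) → ℝ) :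
    exchangeFactor s i.succ p = s (p i.succ) (p i.castSucc) *
      exchangeFactor s i.castSucc (p ∘ Equiv.swap i.castSucc i.succ) := by
  have hIio : Finset.Iio i.succ = insert i.castSucc (Finset.Iio i.castSucc) := by
    ext j
    simp only [Finset.mem_Iio, Finset.mem_insert, Fin.lt_def, Fin.ext_iff, Fin.val_succ,
      Fin.val_castSucc]
    omega
  rw [exchangeFactor, hIio, Finset.prod_insert (by simp), exchangeFactor]
  congr 1
  refine Finset.prod_congr rfl fun l hl => ?_
  have hl : l < i.castSucc := Finset.mem_Iio.1 hl
  simp only [Function.comp_apply, Equiv.swap_apply_left,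
    Equiv.swap_apply_of_ne_of_ne hl.ne (hl.trans Fin.castSucc_lt_succ).ne]

theorem exchangeFactor_comp_swap_of_ne (s : ℝ → ℝ → ℂ) {i : Fin n} {k : Fin (n + 1)}
    (h₀ : k ≠ i.castSucc) (h₁ : k ≠ i.succ) (p : Fin (n + 1) → ℝ) :
    exchangeFactor s k (p ∘ Equiv.swap i.castSucc i.succ) = exchangeFactor s k p := by
  have hlt (l : Fin (n + 1)) : l < k ↔ Equiv.swap i.castSucc i.succ l < k := by
    simp only [Equiv.swap_apply_def, Ne, Fin.lt_def, Fin.ext_iff] at h₀ h₁ ⊢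
    split_ifs <;> simp_all <;> omega
  simp only [exchangeFactor, Function.comp_apply, Equiv.swap_apply_of_ne_of_ne h₀ h₁]
  exact Finset.prod_equiv (Equiv.swap i.castSucc i.succ)
    (fun l => by simpa only [Finset.mem_Iio] using hlt l) fun _ _ => rfl

theorem exchangeFactor_mul_conj (hs : ∀ p q, s p q * conj (s p q) = 1) (k : Fin n)
    (p : Fin n → ℝ) : exchangeFactor s k p * conj (exchangeFactor s k p) = 1 := by
  rw [exchangeFactor, map_prod, ← Finset.prod_mul_distrib]
  exact Finset.prod_eq_one fun l _ => hs _ _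

theorem norm_exchangeFactor (hs : ∀ p q, s p q * conj (s p q) = 1) (k : Fin n)
    (p : Fin n → ℝ) : ‖exchangeFactor s k p‖ = 1 := by
  have h := congrArg norm (exchangeFactor_mul_conj hs k p)
  rw [norm_mul, RCLike.norm_conj, norm_one, ← sq] at h
  exact (pow_eq_one_iff_of_nonneg (norm_nonneg _) two_ne_zero).1 h

theorem measurable_exchangeFactor (hs : Measurable (Function.uncurry s)) (k : Fin n) :
    Measurable (exchangeFactor s k) :=
  Finset.measurable_fun_prod _ fun l _ =>
    Measurable.comp (g := Function.uncurry s) (f := fun p : Fin n → ℝ => (p k, p l)) hs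
      ((measurable_pi_apply k).prodMk (measurable_pi_apply l))

/-- The function `φ ⊗ Ψ` with the variable of `φ` moved from the front to position `k`, including
the factor this produces. -/
def insertFun (s : ℝ → ℝ → ℂ) (φ : ℝ → ℂ) {n : ℕ} (Ψ : (Fin n → ℝ) → ℂ) (k : Fin (n + 1))
    (p : Fin (n + 1) → ℝ) : ℂ :=
  exchangeFactor s k p * (φ (p k) * Ψ (k.removeNth p))

/-- The average over the insertion positions, equal to `√(n+1) P_{n+1}(φ ⊗ Ψ)` for `s`-symmetric
`Ψ` (`create_ae_eq`). -/
def createFun (s : ℝ → ℝ → ℂ) (φ : ℝ → ℂ) {n : ℕ} (Ψ : (Fin n → ℝ) → ℂ)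
    (p : Fin (n + 1) → ℝ) : ℂ :=
  ((Real.sqrt (n + 1) : ℝ) : ℂ)⁻¹ * ∑ k, insertFun s φ Ψ k p

theorem exchange_eq_swap_castSucc_succ (s : ℝ → ℝ → ℂ) (i : Fin n) (Φ : (Fin (n + 1) → ℝ) → ℂ)
    (p : Fin (n + 1) → ℝ) :
    exchange s i i.succ.is_lt Φ p =
      s (p i.succ) (p i.castSucc) * Φ (p ∘ Equiv.swap i.castSucc i.succ) := rfl

theorem exchange_insertFun_castSucc (s : ℝ → ℝ → ℂ) (φ : ℝ → ℂ) (Ψ : (Fin n → ℝ) → ℂ) (i : Fin n)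
    (p : Fin (n + 1) → ℝ) :
    exchange s i i.succ.is_lt (insertFun s φ Ψ i.castSucc) p = insertFun s φ Ψ i.succ p := by
  rw [exchange_eq_swap_castSucc_succ, insertFun, insertFun, castSucc_removeNth_comp_swap,
    exchangeFactor_succ, mul_assoc, Function.comp_apply, Equiv.swap_apply_left]

theorem exchange_exchange (hs : ∀ p q, s p q * s q p = 1) {j : ℕ} (hj : j + 1 < n)
    (Φ : (Fin n → ℝ) → ℂ) : exchange s j hj (exchange s j hj Φ) = Φ := by
  funext p
  simp only [exchange, Function.comp_apply, Equiv.swap_apply_left, Equiv.swap_apply_right,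
    Function.comp_assoc, ← Equiv.coe_trans, Equiv.swap_swap, Equiv.coe_refl, Function.comp_id,
    ← mul_assoc, hs, one_mul]

theorem exchange_insertFun_of_ne (s : ℝ → ℝ → ℂ) (φ : ℝ → ℂ) {Ψ : (Fin n → ℝ) → ℂ} {i : Fin n}
    {k : Fin (n + 1)} (h₀ : k ≠ i.castSucc) (h₁ : k ≠ i.succ) {p : Fin (n + 1) → ℝ}
    (hΨ : ∀ j (hj : j + 1 < n), exchange s j hj Ψ (k.removeNth p) = Ψ (k.removeNth p)) :
    exchange s i i.succ.is_lt (insertFun s φ Ψ k) p = insertFun s φ Ψ k p := by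
  obtain ⟨j, hj, hj₀, hj₁⟩ := exists_succAbove_eq_castSucc_and_succ h₀ h₁
  have hremove : k.removeNth (p ∘ Equiv.swap i.castSucc i.succ) =
      k.removeNth p ∘ Equiv.swap ⟨j, Nat.lt_of_succ_lt hj⟩ ⟨j + 1, hj⟩ := by
    rw [← hj₀, ← hj₁]
    exact funext fun l => congrArg p (Fin.succAbove_right_injective.swap_apply _ _ l)
  have hΨj : s (p i.succ) (p i.castSucc) * Ψ (k.removeNth (p ∘ Equiv.swap i.castSucc i.succ)) =
      Ψ (k.removeNth p) := by
    rw [hremove, ← hj₀, ← hj₁]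
    exact hΨ j hj
  rw [exchange_eq_swap_castSucc_succ, insertFun, insertFun,
    exchangeFactor_comp_swap_of_ne s h₀ h₁, Function.comp_apply,
    Equiv.swap_apply_of_ne_of_ne h₀ h₁, ← hΨj]
  ring

theorem exchange_insertFun (hs : ∀ p q, s p q * s q p = 1) (φ : ℝ → ℂ) {Ψ : (Fin n → ℝ) → ℂ}
    {p : Fin (n + 1) → ℝ}
    (hΨ : ∀ (k : Fin (n + 1)) (j : ℕ) (hj : j + 1 < n),
      exchange s j hj Ψ (k.removeNth p) = Ψ (k.removeNth p))
    (i : Fin n) (k : Fin (n + 1)) :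
    exchange s i i.succ.is_lt (insertFun s φ Ψ k) p =
      insertFun s φ Ψ (Equiv.swap i.castSucc i.succ k) p := by
  by_cases h₀ : k = i.castSucc
  · rw [h₀, Equiv.swap_apply_left, exchange_insertFun_castSucc]
  by_cases h₁ : k = i.succ
  · rw [h₁, Equiv.swap_apply_right, ← funext (exchange_insertFun_castSucc s φ Ψ i),
      exchange_exchange hs]
  · rw [Equiv.swap_apply_of_ne_of_ne h₀ h₁, exchange_insertFun_of_ne s φ h₀ h₁ (hΨ k)]

theorem exchange_createFun (hs : ∀ p q, s p q * s q p = 1) (φ : ℝ → ℂ) {Ψ : (Fin n → ℝ) → ℂ}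
    {p : Fin (n + 1) → ℝ}
    (hΨ : ∀ (k : Fin (n + 1)) (j : ℕ) (hj : j + 1 < n),
      exchange s j hj Ψ (k.removeNth p) = Ψ (k.removeNth p)) (i : Fin n) :
    exchange s i i.succ.is_lt (createFun s φ Ψ) p = createFun s φ Ψ p := by
  rw [exchange, createFun, createFun, mul_left_comm, Finset.mul_sum,
    ← Equiv.sum_comp (Equiv.swap i.castSucc i.succ) fun k => insertFun s φ Ψ k p]
  exact congrArg _ (Finset.sum_congr rfl fun k _ => exchange_insertFun hs φ hΨ i k)

end Combinatorics

/-! ### The projected tensor product -/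

/-- Kernels for which `exchange` generates a unitary representation of the symmetric group on the
measurable functions. -/
structure IsExchangeKernel (s : ℝ → ℝ → ℂ) : Prop where
  measurable : Measurable (Function.uncurry s)
  mul_conj : ∀ p q, s p q * conj (s p q) = 1
  mul_swap : ∀ p q, s p q * s q p = 1

section Creation

variable {μ : Measure ℝ} [SigmaFinite μ] {s : ℝ → ℝ → ℂ} {n : ℕ}

theorem quasiMeasurePreserving_removeNth (μ : Measure ℝ) [SigmaFinite μ] (k : Fin (n + 1)) :
    Measure.QuasiMeasurePreserving (fun p : Fin (n + 1) → ℝ => k.removeNth p)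
      (Measure.pi fun _ => μ) (Measure.pi fun _ => μ) :=
  Measure.quasiMeasurePreserving_snd.comp
    (measurePreserving_piFinSuccAbove (fun _ => μ) k).quasiMeasurePreserving

theorem ae_eq_exchangeFactor_mul (Φ : nParticle μ s (n + 1)) (k : Fin (n + 1)) :
    ∀ᵐ p ∂Measure.pi fun _ => μ, (Φ : TensorPower μ (n + 1)) p =
      exchangeFactor s k p * (Φ : TensorPower μ (n + 1)) (p ∘ k.cycleRange.symm) := by
  induction k using Fin.induction with
  | zero =>
    refine Eventually.of_forall fun p => ?_
    rw [exchangeFactor_zero, one_mul, Fin.cycleRange_zero]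
    rfl
  | succ i ih =>
    have ih_swap := (measurePreserving_perm μ
      (Equiv.swap i.castSucc i.succ)).quasiMeasurePreserving.ae ih
    filter_upwards [Φ.2 i i.succ.is_lt, ih_swap] with p hp hp_swap
    have hcycle : (p ∘ Equiv.swap i.castSucc i.succ) ∘ i.castSucc.cycleRange.symm =
        p ∘ i.succ.cycleRange.symm :=
      funext fun j => congrArg p (swap_castSucc_succ_cycleRange_symm i j)
    rw [← hp, exchange_eq_swap_castSucc_succ, hp_swap, hcycle, exchangeFactor_succ, mul_assoc]

theorem insertFun_eq_tensor_comp (φ : ℝ → ℂ) (Ψ : (Fin n → ℝ) → ℂ) (k : Fin (n + 1)) :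
    insertFun s φ Ψ k = fun p => exchangeFactor s k p *
      (fun q : Fin (n + 1) → ℝ => φ (q 0) * Ψ (Fin.tail q)) (p ∘ k.cycleRange.symm) := by
  funext p
  simp only [insertFun, tail_comp_cycleRange_symm, Function.comp_apply, Fin.cycleRange_symm_zero]

theorem memLp_insertFun (hs : IsExchangeKernel s) (φ : Lp ℂ 2 μ) (Ψ : TensorPower μ n)
    (k : Fin (n + 1)) : MemLp (insertFun s φ Ψ k) 2 (Measure.pi fun _ => μ) := by
  have hmem := (memLp_tensor φ Ψ).comp_measurePreserving
    (measurePreserving_perm μ k.cycleRange.symm)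
  rw [insertFun_eq_tensor_comp]
  refine hmem.of_le
    ((measurable_exchangeFactor hs.measurable k).aestronglyMeasurable.mul hmem.1) ?_
  refine Eventually.of_forall fun p => ?_
  rw [norm_mul, norm_exchangeFactor hs.mul_conj, one_mul]
  rfl

theorem memLp_createFun (hs : IsExchangeKernel s) (φ : Lp ℂ 2 μ) (Ψ : TensorPower μ n) :
    MemLp (createFun s φ Ψ) 2 (Measure.pi fun _ => μ) :=
  (memLp_finsetSum _ fun k _ => memLp_insertFun hs φ Ψ k).const_mul _

/-- Both factors of the integrand acquire the same phase when the `k`-th variable is moved to the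
front, so the phases cancel. -/
theorem integral_conj_mul_insertFun (hs : ∀ p q, s p q * conj (s p q) = 1) (φ : Lp ℂ 2 μ)
    (Ψ : TensorPower μ n) (Φ : nParticle μ s (n + 1)) (k : Fin (n + 1)) :
    ∫ p, conj ((Φ : TensorPower μ (n + 1)) p) * insertFun s φ Ψ k p ∂(Measure.pi fun _ => μ) =
      ∫ p, conj ((Φ : TensorPower μ (n + 1)) p) * (φ (p 0) * Ψ (Fin.tail p))
        ∂Measure.pi fun _ => μ := by
  have hperm := measurePreserving_perm μ k.cycleRange.symm
  have hmeas : AEStronglyMeasurable (fun p =>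
      conj ((Φ : TensorPower μ (n + 1)) p) * (φ (p 0) * Ψ (Fin.tail p)))
      (Measure.map (fun p : Fin (n + 1) → ℝ => p ∘ k.cycleRange.symm) (Measure.pi fun _ => μ)) := by
    rw [hperm.map_eq]
    exact (Lp.memLp (Φ : TensorPower μ (n + 1))).1.star.mul (memLp_tensor φ Ψ).1
  have hmap := integral_map hperm.measurable.aemeasurable hmeas
  rw [hperm.map_eq] at hmap
  rw [hmap]
  refine integral_congr_ae ?_
  filter_upwards [ae_eq_exchangeFactor_mul Φ k] with p hp
  rw [hp, insertFun_eq_tensor_comp, map_mul, mul_mul_mul_comm,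
    mul_comm (conj (exchangeFactor s k p)), exchangeFactor_mul_conj hs, one_mul]

theorem exchange_congr_ae {j : ℕ} (hj : j + 1 < n) {Φ Φ' : (Fin n → ℝ) → ℂ}
    (h : Φ =ᵐ[Measure.pi fun _ => μ] Φ') :
    exchange s j hj Φ =ᵐ[Measure.pi fun _ => μ] exchange s j hj Φ' := by
  filter_upwards [(measurePreserving_perm μ _).quasiMeasurePreserving.ae h] with p hp
  rw [exchange, exchange, hp]

theorem exchange_createFun_ae_eq (hs : ∀ p q, s p q * s q p = 1) (φ : ℝ → ℂ)
    (Ψ : nParticle μ s n) (j : ℕ) (hj : j + 1 < n + 1) :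
    exchange s j hj (createFun s φ (Ψ : TensorPower μ n)) =ᵐ[Measure.pi fun _ => μ]
      createFun s φ (Ψ : TensorPower μ n) := by
  have hΨ : ∀ᵐ p ∂Measure.pi fun _ : Fin (n + 1) => μ, ∀ (k : Fin (n + 1)) (i : ℕ)
      (hi : i + 1 < n), exchange s i hi (Ψ : TensorPower μ n) (k.removeNth p) =
        (Ψ : TensorPower μ n) (k.removeNth p) := by
    simp only [ae_all_iff]
    exact fun k i hi => (quasiMeasurePreserving_removeNth μ k).ae (Ψ.2 i hi)
  filter_upwards [hΨ] with p hp
  exact exchange_createFun hs φ hp ⟨j, Nat.lt_of_succ_lt_succ hj⟩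

theorem toLp_createFun_mem_nParticle (hs : IsExchangeKernel s) (φ : Lp ℂ 2 μ)
    (Ψ : nParticle μ s n) :
    (memLp_createFun hs φ (Ψ : TensorPower μ n)).toLp _ ∈ nParticle μ s (n + 1) := fun j hj =>
  have hcoe := (memLp_createFun hs φ (Ψ : TensorPower μ n)).coeFn_toLp
  (exchange_congr_ae hj hcoe).trans
    ((exchange_createFun_ae_eq hs.mul_swap φ Ψ j hj).trans hcoe.symm)

theorem inner_toLp_createFun (hs : IsExchangeKernel s) (φ : Lp ℂ 2 μ) (Ψ : TensorPower μ n)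
    (Φ : nParticle μ s (n + 1)) :
    inner ℂ (Φ : TensorPower μ (n + 1)) ((memLp_createFun hs φ Ψ).toLp _) =
      ((Real.sqrt (n + 1) : ℝ) : ℂ) * inner ℂ (Φ : TensorPower μ (n + 1)) (tensor n φ Ψ) := by
  have htensor : inner ℂ (Φ : TensorPower μ (n + 1)) (tensor n φ Ψ) =
      ∫ p, conj ((Φ : TensorPower μ (n + 1)) p) * (φ (p 0) * Ψ (Fin.tail p))
        ∂Measure.pi fun _ => μ := by
    refine integral_congr_ae ?_
    filter_upwards [(memLp_tensor φ Ψ).coeFn_toLp] with p hp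
    exact (RCLike.inner_apply' _ _).trans (congrArg _ hp)
  have hcreate : inner ℂ (Φ : TensorPower μ (n + 1)) ((memLp_createFun hs φ Ψ).toLp _) =
      ∫ p, ((Real.sqrt (n + 1) : ℝ) : ℂ)⁻¹ * ∑ k, conj ((Φ : TensorPower μ (n + 1)) p) *
        insertFun s φ Ψ k p ∂Measure.pi fun _ => μ := by
    refine integral_congr_ae ?_
    filter_upwards [(memLp_createFun hs φ Ψ).coeFn_toLp] with p hp
    rw [RCLike.inner_apply', hp, createFun, ← Finset.mul_sum, mul_left_comm]
  have hint (k : Fin (n + 1)) : Integrable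
      (fun p => conj ((Φ : TensorPower μ (n + 1)) p) * insertFun s φ Ψ k p)
      (Measure.pi fun _ => μ) :=
    MemLp.integrable_mul (Lp.memLp (Φ : TensorPower μ (n + 1))).star (memLp_insertFun hs φ Ψ k)
  have hsqrt : ((Real.sqrt (n + 1) : ℝ) : ℂ)⁻¹ * (n + 1) = ((Real.sqrt (n + 1) : ℝ) : ℂ) := by
    have h : (Real.sqrt (n + 1))⁻¹ * (n + 1) = Real.sqrt (n + 1) := by
      rw [mul_comm, ← div_eq_mul_inv, Real.div_sqrt]
    exact_mod_cast h
  simp only [hcreate, htensor, integral_const_mul, integral_finsetSum _ fun k _ => hint k,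
    integral_conj_mul_insertFun hs.mul_conj, Finset.sum_const, Finset.card_univ,
    Fintype.card_fin, nsmul_eq_mul, Nat.cast_add, Nat.cast_one]
  rw [← mul_assoc, hsqrt]

theorem create_ae_eq (hs : IsExchangeKernel s) (φ : Lp ℂ 2 μ) (Ψ : nParticle μ s n) :
    ((create s n φ Ψ : nParticle μ s (n + 1)) : TensorPower μ (n + 1))
      =ᵐ[Measure.pi fun _ => μ] createFun s φ (Ψ : TensorPower μ n) := by
  have hproj : (nParticle μ s (n + 1)).starProjection
      (((Real.sqrt (n + 1) : ℝ) : ℂ) • tensor n φ (Ψ : TensorPower μ n)) =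
        (memLp_createFun hs φ (Ψ : TensorPower μ n)).toLp _ := by
    refine Submodule.eq_starProjection_of_mem_of_inner_eq_zero
      (toLp_createFun_mem_nParticle hs φ Ψ) fun Φ hΦ => ?_
    rw [inner_eq_zero_symm, inner_sub_right, inner_smul_right, sub_eq_zero]
    exact (inner_toLp_createFun hs φ (Ψ : TensorPower μ n) ⟨Φ, hΦ⟩).symm
  have hcreate : ((create s n φ Ψ : nParticle μ s (n + 1)) : TensorPower μ (n + 1)) =
      (memLp_createFun hs φ (Ψ : TensorPower μ n)).toLp _ := by
    rw [← hproj, map_smul]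
    rfl
  exact hcreate ▸ (memLp_createFun hs φ (Ψ : TensorPower μ n)).coeFn_toLp

end Creation

/-! ### Wave functions of Fock vectors -/

section WaveFunctions

variable {μ : Measure ℝ} [SigmaFinite μ] {s : ℝ → ℝ → ℂ}

/-- The functions `F n` are representatives of the `n`-particle components of `X`. -/
def IsRepresentedBy (X : Fock μ s) (F : ∀ n, (Fin n → ℝ) → ℂ) : Prop :=
  ∀ n, ((X n : nParticle μ s n) : TensorPower μ n) =ᵐ[Measure.pi fun _ => μ] F n

/-- The representatives `(1, 0, 0, …)` of the vacuum. -/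
def vacuumFun (n : ℕ) (_ : Fin n → ℝ) : ℂ := if n = 0 then 1 else 0

/-- The action of `creation` on representatives. -/
def creationFun (s : ℝ → ℝ → ℂ) (φ : ℝ → ℂ) (F : ∀ n, (Fin n → ℝ) → ℂ) :
    ∀ n, (Fin n → ℝ) → ℂ
  | 0 => 0
  | k + 1 => createFun s φ (F k)

/-- The action of `field` on representatives. -/
def fieldFun (S : ℂ → ℂ) (m : ℝ) (f : 𝓢(Spacetime, ℂ)) (F : ∀ n, (Fin n → ℝ) → ℂ) (n : ℕ)
    (p : Fin n → ℝ) : ℂ :=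
  creationFun (kernel S m) (massShell 1 m f) F n p +
    annihilateFun (μ := momentumMeasure m) (massShell (-1) m f) (F (n + 1)) p

/-- The representatives of the components of `φ_m(f_1) ⋯ φ_m(f_k) Ω_m`. -/
def stateFun (S : ℂ → ℂ) (m : ℝ) (fs : List 𝓢(Spacetime, ℂ)) : ∀ n, (Fin n → ℝ) → ℂ :=
  fs.foldr (fieldFun S m) vacuumFun

theorem createFun_congr_ae (s : ℝ → ℝ → ℂ) {φ φ' : ℝ → ℂ} {n : ℕ} {Ψ Ψ' : (Fin n → ℝ) → ℂ}
    (hφ : φ =ᵐ[μ] φ') (hΨ : Ψ =ᵐ[Measure.pi fun _ => μ] Ψ') :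
    createFun s φ Ψ =ᵐ[Measure.pi fun _ => μ] createFun s φ' Ψ' := by
  have hφ_eval : ∀ᵐ p ∂(Measure.pi fun _ : Fin (n + 1) => μ), ∀ k, φ (p k) = φ' (p k) :=
    ae_all_iff.2 fun k => (Measure.quasiMeasurePreserving_eval (fun _ => μ) k).ae hφ
  have hΨ_removeNth : ∀ᵐ p ∂(Measure.pi fun _ : Fin (n + 1) => μ), ∀ k : Fin (n + 1),
      Ψ (k.removeNth p) = Ψ' (k.removeNth p) :=
    ae_all_iff.2 fun k => (quasiMeasurePreserving_removeNth μ k).ae hΨ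
  filter_upwards [hφ_eval, hΨ_removeNth] with p hφp hΨp
  simp only [createFun, insertFun, hφp, hΨp]

theorem annihilateFun_congr_ae {φ φ' : ℝ → ℂ} {n : ℕ} {Ψ Ψ' : (Fin (n + 1) → ℝ) → ℂ}
    (hφ : φ =ᵐ[μ] φ') (hΨ : Ψ =ᵐ[Measure.pi fun _ => μ] Ψ') :
    annihilateFun (μ := μ) φ Ψ =ᵐ[Measure.pi fun _ => μ] annihilateFun (μ := μ) φ' Ψ' := by
  filter_upwards [ae_ae_cons hΨ] with p hp
  exact congrArg _ (integral_congr_ae (hφ.mul hp))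

theorem isRepresentedBy_vacuum (μ : Measure ℝ) [SigmaFinite μ] (s : ℝ → ℝ → ℂ) :
    IsRepresentedBy (vacuum μ s : Fock μ s) vacuumFun
  | 0 => (memLp_one μ).coeFn_toLp
  | _ + 1 => Lp.coeFn_zero ℂ 2 _

section Operators

variable {X Y : finiteParticle μ s} {F G : ∀ n, (Fin n → ℝ) → ℂ}

theorem IsRepresentedBy.add (hX : IsRepresentedBy (X : Fock μ s) F)
    (hY : IsRepresentedBy (Y : Fock μ s) G) :
    IsRepresentedBy ((X + Y : finiteParticle μ s) : Fock μ s) (F + G) := fun n =>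
  (Lp.coeFn_add ((X : Fock μ s) n).1 ((Y : Fock μ s) n).1).trans ((hX n).add (hY n))

theorem IsRepresentedBy.creation (hs : IsExchangeKernel s)
    (hX : IsRepresentedBy (X : Fock μ s) F) {φ : Lp ℂ 2 μ} {φ' : ℝ → ℂ} (hφ : φ =ᵐ[μ] φ') :
    IsRepresentedBy (creation s φ X : Fock μ s) (creationFun s φ' F)
  | 0 => Lp.coeFn_zero ℂ 2 _
  | k + 1 => (create_ae_eq hs φ ((X : Fock μ s) k)).trans (createFun_congr_ae s hφ (hX k))

theorem IsRepresentedBy.annihilation (hX : IsRepresentedBy (X : Fock μ s) F) {φ : Lp ℂ 2 μ}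
    {φ' : ℝ → ℂ} (hφ : φ =ᵐ[μ] φ') :
    IsRepresentedBy (annihilation s φ X : Fock μ s)
      fun n => annihilateFun (μ := μ) φ' (F (n + 1)) := fun n =>
  (memLp_annihilate φ ((X : Fock μ s) (n + 1)).1).coeFn_toLp.trans
    (annihilateFun_congr_ae hφ (hX (n + 1)))

end Operators

theorem integral_pi_fin_zero (μ : Measure ℝ) (F : (Fin 0 → ℝ) → ℂ) :
    ∫ p, F p ∂(Measure.pi fun _ : Fin 0 => μ) = F ![] := by
  rw [Measure.pi_of_empty _ ![]]
  exact integral_dirac _ _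

theorem inner_vacuum (X : Fock μ s) :
    inner ℂ (vacuum μ s : Fock μ s) X =
      ∫ p, ((X 0 : nParticle μ s 0) : TensorPower μ 0) p ∂(Measure.pi fun _ : Fin 0 => μ) := by
  have hsucc (n : ℕ) (hn : n ≠ 0) : inner ℂ ((vacuum μ s : Fock μ s) n) (X n) = 0 := by
    obtain ⟨k, rfl⟩ := Nat.exists_eq_succ_of_ne_zero hn
    exact inner_zero_left _
  rw [lp.inner_eq_tsum, tsum_eq_single 0 hsucc, Submodule.coe_inner, L2.inner_def]
  refine integral_congr_ae ?_
  filter_upwards [isRepresentedBy_vacuum μ s 0] with p hp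
  rw [hp, vacuumFun, if_pos rfl, RCLike.inner_apply', map_one, one_mul]

theorem IsRepresentedBy.inner_vacuum_eq {X : Fock μ s} {F : ∀ n, (Fin n → ℝ) → ℂ}
    (hX : IsRepresentedBy X F) : inner ℂ (vacuum μ s : Fock μ s) X = F 0 ![] := by
  rw [inner_vacuum, ← integral_pi_fin_zero μ (F 0)]
  exact integral_congr_ae (hX 0)

end WaveFunctions

section Fields

variable {S : ℂ → ℂ} {m : ℝ}

theorem oneParticle_ae_eq {ε : ℝ} {f : 𝓢(Spacetime, ℂ)}
    (h : MemLp (massShell ε m f) 2 (momentumMeasure m)) :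
    oneParticle ε m f =ᵐ[momentumMeasure m] massShell ε m f := by
  rw [oneParticle, dif_pos h]
  exact h.coeFn_toLp

theorem isRepresentedBy_prod_field_vacuum (hs : IsExchangeKernel (kernel S m))
    {fs : List 𝓢(Spacetime, ℂ)}
    (hcreate : ∀ f ∈ fs, MemLp (massShell 1 m f) 2 (momentumMeasure m))
    (hannihilate : ∀ f ∈ fs, MemLp (massShell (-1) m f) 2 (momentumMeasure m)) :
    IsRepresentedBy
      ((fs.map (field S m)).prod (vacuum _ _) : Fock (momentumMeasure m) (kernel S m))
      (stateFun S m fs) := by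
  induction fs with
  | nil => exact isRepresentedBy_vacuum _ _
  | cons f fs ih =>
    obtain ⟨hf, hfs⟩ := List.forall_mem_cons.1 hcreate
    obtain ⟨hf', hfs'⟩ := List.forall_mem_cons.1 hannihilate
    have hX := ih hfs hfs'
    rw [List.map_cons, List.prod_cons]
    exact (hX.creation hs (oneParticle_ae_eq hf)).add (hX.annihilation (oneParticle_ae_eq hf'))

theorem vacuumExpectation_field (hs : IsExchangeKernel (kernel S m)) {n : ℕ}
    {f : Fin n → 𝓢(Spacetime, ℂ)}
    (hcreate : ∀ j, MemLp (massShell 1 m (f j)) 2 (momentumMeasure m))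
    (hannihilate : ∀ j, MemLp (massShell (-1) m (f j)) 2 (momentumMeasure m)) :
    vacuumExpectation (fun j => field S m (f j)) = stateFun S m (List.ofFn f) 0 ![] := by
  have hmap : (List.ofFn fun j => field S m (f j)) = (List.ofFn f).map (field S m) := by
    rw [List.map_ofFn]
    rfl
  rw [vacuumExpectation, hmap]
  exact (isRepresentedBy_prod_field_vacuum hs (List.forall_mem_ofFn_iff.2 hcreate)
    (List.forall_mem_ofFn_iff.2 hannihilate)).inner_vacuum_eq

end Fields

/-! ### Reflected operators -/

section Reflection

variable {μ : Measure ℝ} [SigmaFinite μ] {s : ℝ → ℝ → ℂ} (hs : ∀ p q, s p q * conj (s p q) = 1)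

/-- The operator `J A J⁻¹`, where `J` is the antilinear involution `reflection`. -/
def reflectedOperator (A : Module.End ℂ (finiteParticle μ s)) :
    Module.End ℂ (finiteParticle μ s) :=
  (reflection hs).toLinearMap ∘ₛₗ A ∘ₛₗ (reflection hs).symm.toLinearMap

theorem prod_map_reflectedOperator (L : List (Module.End ℂ (finiteParticle μ s))) :
    (L.map (reflectedOperator hs)).prod = reflectedOperator hs L.prod := by
  induction L with
  | nil => exact LinearMap.ext fun X => ((reflection hs).apply_symm_apply X).symm
  | cons A L ih =>
    rw [List.map_cons, List.prod_cons, List.prod_cons, ih]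
    refine LinearMap.ext fun X => congrArg (reflection hs ∘ A) ?_
    exact (reflection hs).symm_apply_apply _

theorem reflection_symm_vacuum : (reflection hs).symm (vacuum μ s) = vacuum μ s := by
  rw [LinearEquiv.symm_apply_eq]
  refine Subtype.ext (Subtype.ext (funext fun n => Subtype.ext ?_))
  cases n with
  | zero =>
    have hone := isRepresentedBy_vacuum μ s 0
    refine Lp.ext (hone.trans ?_)
    filter_upwards [(memLp_reverse ((vacuum μ s : Fock μ s) 0).1).coeFn_toLp,
      (measurePreserving_perm μ Fin.revPerm).quasiMeasurePreserving.ae hone] with p hp hone_rev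
    refine Eq.trans ?_ hp.symm
    rw [hone_rev, vacuumFun, vacuumFun, if_pos rfl, map_one]
  | succ n => exact (map_zero (reverseTensor (μ := μ) (n + 1))).symm

theorem inner_vacuum_reflection (X : finiteParticle μ s) :
    inner ℂ (vacuum μ s : Fock μ s) (reflection hs X : Fock μ s) =
      conj (inner ℂ (vacuum μ s : Fock μ s) (X : Fock μ s)) := by
  rw [inner_vacuum, inner_vacuum, ← integral_conj]
  refine integral_congr_ae ?_
  filter_upwards [(memLp_reverse ((X : Fock μ s) 0).1).coeFn_toLp] with p hp
  refine hp.trans ?_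
  rw [Subsingleton.elim (p ∘ Fin.revPerm) p]

theorem vacuumExpectation_reflectedOperator {n : ℕ}
    (A : Fin n → Module.End ℂ (finiteParticle μ s)) :
    vacuumExpectation (fun j => reflectedOperator hs (A j)) = conj (vacuumExpectation A) := by
  have hmap : (List.ofFn fun j => reflectedOperator hs (A j)) =
      (List.ofFn A).map (reflectedOperator hs) := by
    rw [List.map_ofFn]
    rfl
  rw [vacuumExpectation, hmap, prod_map_reflectedOperator, reflectedOperator,
    LinearMap.comp_apply, LinearMap.comp_apply, LinearEquiv.coe_coe, LinearEquiv.coe_coe,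
    reflection_symm_vacuum]
  exact inner_vacuum_reflection hs _

theorem reflect_rescale {l : ℝ} (hl : 0 < l) (f : 𝓢(Spacetime, ℂ)) :
    reflect (rescale l f) = rescale l (reflect f) := by
  ext x
  rw [reflect_apply, rescale_apply hl, rescale_apply hl, reflect_apply, map_mul, smul_neg,
    map_inv₀, map_pow, Complex.conj_ofReal]

theorem rescale_one (f : 𝓢(Spacetime, ℂ)) : rescale 1 f = f := by
  ext x
  rw [rescale_apply one_pos, Complex.ofReal_one, one_pow, inv_one, one_mul, inv_one, one_smul]

theorem integral_reflect (f : 𝓢(Spacetime, ℂ)) :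
    ∫ x, reflect f x = conj (∫ x, f x) := by
  simp only [reflect_apply]
  rw [integral_conj, integral_neg_eq_self fun x => f x]

end Reflection

/-! ### Scattering functions -/

section BoundaryValues

variable {E : Type*} [NormedAddCommGroup E]

theorem norm_integral_sub_integral_add_mul_I_le [NormedSpace ℂ E] {f : ℂ → E} {h C : ℝ}
    (hh : 0 ≤ h) (hcont : ContinuousOn f (closedStrip 0 h))
    (hdiff : DifferentiableOn ℂ f (openStrip 0 h)) (hC : ∀ z ∈ closedStrip 0 h, ‖f z‖ ≤ C)
    (a b : ℝ) :
    ‖(∫ x : ℝ in a..b, f x) - ∫ x : ℝ in a..b, f (x + h * Complex.I)‖ ≤ 2 * (C * h) := by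
  have hside (x : ℝ) : ‖∫ y : ℝ in (0 : ℝ)..h, f (x + y * Complex.I)‖ ≤ C * h := by
    have hle (y : ℝ) (hy : y ∈ Set.uIoc 0 h) : ‖f (x + y * Complex.I)‖ ≤ C := by
      rw [Set.uIoc_of_le hh] at hy
      exact hC _ (by simpa [closedStrip] using ⟨hy.1.le, hy.2⟩)
    simpa [abs_of_nonneg hh] using intervalIntegral.norm_integral_le_of_norm_le_const hle
  have hrect := Complex.integral_boundary_rect_eq_zero_of_continuousOn_of_differentiableOn f
    (a : ℂ) (b + h * Complex.I)
    (hcont.mono fun z hz => by simpa [Set.uIcc_of_le hh, closedStrip] using hz.2)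
    (hdiff.mono fun z hz => by simpa [hh, openStrip] using hz.2)
  simp only [Complex.add_re, Complex.add_im, Complex.mul_re, Complex.mul_im, Complex.ofReal_re,
    Complex.ofReal_im, Complex.I_re, Complex.I_im, mul_zero, mul_one, zero_mul, sub_self, add_zero,
    zero_add, Complex.ofReal_zero] at hrect
  rw [add_sub_assoc, add_eq_zero_iff_eq_neg, neg_sub] at hrect
  rw [hrect]
  refine (norm_sub_le _ _).trans ?_
  rw [norm_smul, norm_smul, Complex.norm_I, one_mul, one_mul, two_mul]
  exact add_le_add (hside a) (hside b)

theorem eq_zero_of_tendsto_atTop_of_norm_integral_le [NormedSpace ℝ E] [CompleteSpace E]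
    {g : ℝ → E} (hg : Continuous g) {d : E} (hd : Tendsto g atTop (𝓝 d)) {K : ℝ}
    (hK : ∀ a b : ℝ, ‖∫ x in a..b, g x‖ ≤ K) : d = 0 := by
  by_contra hne
  have hpos : 0 < ‖d‖ := norm_pos_iff.2 hne
  obtain ⟨R, hR⟩ := Metric.tendsto_atTop.1 hd (‖d‖ / 2) (half_pos hpos)
  have hgrowth (t : ℝ) (ht : 0 ≤ t) : t * (‖d‖ / 2) ≤ K := by
    have hdev : ‖∫ x in R..R + t, (g x - d)‖ ≤ ‖d‖ / 2 * |R + t - R| := by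
      refine intervalIntegral.norm_integral_le_of_norm_le_const fun x hx => ?_
      rw [Set.uIoc_of_le (le_add_of_nonneg_right ht)] at hx
      exact (dist_eq_norm (g x) d ▸ hR x hx.1.le).le
    rw [intervalIntegral.integral_sub (hg.intervalIntegrable _ _) intervalIntegrable_const,
      intervalIntegral.integral_const, add_sub_cancel_left, abs_of_nonneg ht, norm_sub_rev] at hdev
    have htd := (norm_sub_norm_le _ _).trans hdev
    rw [norm_smul, Real.norm_of_nonneg ht] at htd
    linarith [hK R (R + t)]
  have hK0 : 0 ≤ K := (norm_nonneg _).trans (hK 0 0)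
  have hle := hgrowth (2 * (K + 1) / ‖d‖) (by positivity)
  have heq : 2 * (K + 1) / ‖d‖ * (‖d‖ / 2) = K + 1 := by field_simp
  linarith

end BoundaryValues

section Scattering

variable {S : ℂ → ℂ}

theorem kernel_zero (S : ℂ → ℂ) : kernel S 0 = masslessKernel S := if_pos rfl

theorem kernel_of_ne_zero (S : ℂ → ℂ) {m : ℝ} (hm : m ≠ 0) : kernel S m = massiveKernel S m :=
  if_neg hm

theorem continuous_energy (m : ℝ) : Continuous (energy m) := by
  unfold energy
  fun_prop

theorem energy_zero (p : ℝ) : energy 0 p = |p| := by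
  rw [energy, zero_pow two_ne_zero, add_zero, Real.sqrt_sq_eq_abs]

theorem energy_neg (m p : ℝ) : energy m (-p) = energy m p := by
  rw [energy, energy, neg_sq]

variable (hS : IsScatteringFunction S)
include hS

theorem continuous_scattering : Continuous fun θ : ℝ => S θ :=
  hS.continuousOn.comp_continuous Complex.continuous_ofReal fun θ => by
    simp [closedStrip, Real.pi_pos.le]

theorem scattering_mul_conj (θ : ℝ) : S θ * conj (S θ) = 1 := by
  rw [hS.conj_eq_inv, mul_inv_cancel₀ (hS.ne_zero θ)]

theorem conj_scattering (θ : ℝ) : conj (S θ) = S ((-θ : ℝ) : ℂ) := by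
  rw [hS.conj_eq_inv, hS.inv_eq_crossing, hS.crossing_eq_neg, Complex.ofReal_neg]

theorem scattering_add_pi_mul_I (θ : ℝ) : S (θ + Real.pi * Complex.I) = conj (S θ) := by
  rw [mul_comm, ← hS.inv_eq_crossing, hS.conj_eq_inv]

theorem measurable_kernel (m : ℝ) : Measurable (Function.uncurry (kernel S m)) := by
  have hmeas := (continuous_scattering hS).measurable
  have henergy := continuous_energy m
  rcases eq_or_ne m 0 with rfl | hm
  · rw [kernel_zero]
    refine Measurable.ite ?_ (hmeas.comp (by fun_prop)) (Measurable.ite ?_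
      (hmeas.comp (by fun_prop)) (Measurable.ite ?_ measurable_const measurable_const)) <;>
    measurability
  · rw [kernel_of_ne_zero S hm]
    refine hmeas.comp (f := fun z : ℝ × ℝ =>
      Real.arsinh ((z.1 * energy m z.2 - z.2 * energy m z.1) / m ^ 2)) ?_
    exact (Real.continuous_arsinh.comp (by fun_prop)).measurable

variable (hlim : ∃ a : ℂ, Tendsto (fun θ : ℝ => S θ) atTop (𝓝 a))
include hlim

omit hS in
theorem tendsto_limitValue : Tendsto (fun θ : ℝ => S θ) atTop (𝓝 (limitValue S)) :=
  tendsto_nhds_limUnder hlim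

theorem limitValue_mul_conj : limitValue S * conj (limitValue S) = 1 := by
  have ht := tendsto_limitValue hlim
  refine tendsto_nhds_unique (ht.mul ((Complex.continuous_conj.tendsto _).comp ht)) ?_
  exact tendsto_const_nhds.congr fun θ => (scattering_mul_conj hS θ).symm

/-- `S` has boundary values `S θ` and `conj (S θ)` on the two edges of the strip. By Cauchy's
theorem their integrals over `[a, b]` differ by a bounded amount, so their limits agree. -/
theorem conj_limitValue : conj (limitValue S) = limitValue S := by
  obtain ⟨C, hC⟩ := hS.bounded
  have hcont := continuous_scattering hS
  have hcont_conj : Continuous fun θ : ℝ => conj (S θ) := Complex.continuous_conj.comp hcont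
  have ht := tendsto_limitValue hlim
  have hdiff := ht.sub ((Complex.continuous_conj.tendsto _).comp ht)
  refine (sub_eq_zero.1 (eq_zero_of_tendsto_atTop_of_norm_integral_le
    (hcont.sub hcont_conj) hdiff (K := 2 * (C * Real.pi)) fun a b => ?_)).symm
  change ‖∫ θ in a..b, (S θ - conj (S θ))‖ ≤ _
  rw [intervalIntegral.integral_sub (hcont.intervalIntegrable _ _)
    (hcont_conj.intervalIntegrable _ _)]
  simp only [← scattering_add_pi_mul_I hS]
  exact norm_integral_sub_integral_add_mul_I_le Real.pi_pos.le hS.continuousOn hS.analytic hC a b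

theorem kernel_mul_conj (m p q : ℝ) : kernel S m p q * conj (kernel S m p q) = 1 := by
  rw [kernel]
  split_ifs
  · rw [masslessKernel]
    split_ifs
    · exact scattering_mul_conj hS _
    · exact scattering_mul_conj hS _
    · exact scattering_mul_conj hS 0
    · exact limitValue_mul_conj hS hlim
  · exact scattering_mul_conj hS _

theorem conj_kernel (m p q : ℝ) : conj (kernel S m p q) = kernel S m q p := by
  have hconj (θ θ' : ℝ) (h : θ' = -θ) : conj (S θ) = S θ' := h ▸ conj_scattering hS θ
  rcases eq_or_ne m 0 with rfl | hm
  · simp only [kernel_zero, masslessKernel, and_comm (a := 0 < q), and_comm (a := q < 0),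
      and_comm (a := q = 0)]
    split_ifs
    · exact hconj _ _ (neg_sub _ _).symm
    · exact hconj _ _ (neg_sub _ _).symm
    · simpa using hconj 0 0 neg_zero.symm
    · exact conj_limitValue hS hlim
  · rw [kernel_of_ne_zero S hm]
    refine hconj _ _ ?_
    rw [← Real.arsinh_neg, ← neg_div, neg_sub]

theorem isExchangeKernel_kernel (m : ℝ) : IsExchangeKernel (kernel S m) where
  measurable := measurable_kernel hS m
  mul_conj := kernel_mul_conj hS hlim m
  mul_swap p q := by rw [← conj_kernel hS hlim m p q, kernel_mul_conj hS hlim]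

end Scattering

/-! ### The massless limit of the kernel -/

section KernelLimit

variable {m : ℝ}

theorem sqrt_one_add_div_sq (hm : 0 < m) (p : ℝ) : √(1 + (p / m) ^ 2) = energy m p / m := by
  have h : 1 + (p / m) ^ 2 = (p ^ 2 + m ^ 2) / m ^ 2 := by field_simp; ring
  rw [h, Real.sqrt_div (by positivity), Real.sqrt_sq hm.le, energy]

theorem arsinh_energy_sub_div_sq (hm : 0 < m) (p q : ℝ) :
    Real.arsinh ((p * energy m q - q * energy m p) / m ^ 2) =
      Real.arsinh (p / m) - Real.arsinh (q / m) := by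
  rw [← Real.arsinh_sinh (Real.arsinh (p / m) - Real.arsinh (q / m)), Real.sinh_sub,
    Real.sinh_arsinh, Real.sinh_arsinh, Real.cosh_arsinh, Real.cosh_arsinh,
    sqrt_one_add_div_sq hm, sqrt_one_add_div_sq hm]
  congr 1
  field_simp

theorem massiveKernel_eq (S : ℂ → ℂ) (hm : 0 < m) (p q : ℝ) :
    massiveKernel S m p q = S ((Real.arsinh (p / m) - Real.arsinh (q / m) : ℝ) : ℂ) := by
  rw [massiveKernel, arsinh_energy_sub_div_sq hm]

theorem arsinh_div_add_log (hm : 0 < m) {p : ℝ} (hp : 0 < p) :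
    Real.arsinh (p / m) + Real.log m = Real.log (p + energy m p) := by
  have henergy : 0 ≤ energy m p := Real.sqrt_nonneg _
  rw [Real.arsinh, sqrt_one_add_div_sq hm, ← add_div,
    Real.log_div (by positivity) hm.ne', sub_add_cancel]

theorem continuous_energy_mass (p : ℝ) : Continuous fun m => energy m p := by
  unfold energy
  fun_prop

theorem tendsto_arsinh_div_add_log {p : ℝ} (hp : 0 < p) :
    Tendsto (fun m => Real.arsinh (p / m) + Real.log m) (𝓝[>] 0) (𝓝 (Real.log 2 + Real.log p)) := by
  have henergy := ((continuous_energy_mass p).tendsto 0).const_add p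
  rw [energy_zero, abs_of_pos hp, ← two_mul] at henergy
  rw [← Real.log_mul two_ne_zero hp.ne']
  refine ((henergy.log (by positivity)).mono_left nhdsWithin_le_nhds).congr' ?_
  filter_upwards [self_mem_nhdsWithin] with m hm
  exact (arsinh_div_add_log hm hp).symm

theorem tendsto_arsinh_div_atTop {p : ℝ} (hp : 0 < p) :
    Tendsto (fun m => Real.arsinh (p / m)) (𝓝[>] 0) atTop := by
  have hlog : Tendsto (fun m => -Real.log m) (𝓝[>] 0) atTop :=
    tendsto_neg_atBot_atTop.comp Real.tendsto_log_nhdsGT_zero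
  exact ((tendsto_arsinh_div_add_log hp).add_atTop hlog).congr fun m => add_neg_cancel_right _ _

theorem kernel_neg_neg (S : ℂ → ℂ) (m p q : ℝ) : kernel S m (-p) (-q) = kernel S m q p := by
  rcases eq_or_ne m 0 with rfl | hm
  · rw [kernel_zero, masslessKernel, masslessKernel]
    simp only [neg_pos, neg_neg, neg_lt_zero, neg_eq_zero]
    split_ifs <;> first | rfl | (exfalso; grind)
  · rw [kernel_of_ne_zero S hm, massiveKernel, massiveKernel, energy_neg, energy_neg]
    congr 3
    ring

variable {S : ℂ → ℂ} {p q : ℝ}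

theorem tendsto_kernel_of_pos (hS : IsScatteringFunction S) (hp : 0 < p) (hq : 0 < q) :
    Tendsto (fun m => kernel S m p q) (𝓝[>] 0) (𝓝 (kernel S 0 p q)) := by
  have hrapidity := (tendsto_arsinh_div_add_log hp).sub (tendsto_arsinh_div_add_log hq)
  rw [add_sub_add_left_eq_sub] at hrapidity
  rw [kernel_zero, masslessKernel, if_pos ⟨hp, hq⟩]
  refine (((continuous_scattering hS).tendsto _).comp hrapidity).congr' ?_
  filter_upwards [self_mem_nhdsWithin] with m hm
  rw [kernel_of_ne_zero S (ne_of_gt hm), massiveKernel_eq S hm, Function.comp_apply,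
    add_sub_add_right_eq_sub]

theorem tendsto_kernel_of_pos_of_neg (hlim : ∃ a : ℂ, Tendsto (fun θ : ℝ => S θ) atTop (𝓝 a))
    (hp : 0 < p) (hq : q < 0) :
    Tendsto (fun m => kernel S m p q) (𝓝[>] 0) (𝓝 (kernel S 0 p q)) := by
  have hrapidity := (tendsto_arsinh_div_atTop hp).atTop_add_atTop
    (tendsto_arsinh_div_atTop (neg_pos.2 hq))
  rw [kernel_zero, masslessKernel, if_neg fun h => hq.not_gt h.2, if_neg fun h => hp.not_gt h.1,
    if_neg fun h => hp.ne' h.1]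
  refine ((tendsto_limitValue hlim).comp hrapidity).congr' ?_
  filter_upwards [self_mem_nhdsWithin] with m hm
  rw [kernel_of_ne_zero S (ne_of_gt hm), massiveKernel_eq S hm, Function.comp_apply, neg_div,
    Real.arsinh_neg, sub_eq_add_neg]

theorem tendsto_kernel (hS : IsScatteringFunction S)
    (hlim : ∃ a : ℂ, Tendsto (fun θ : ℝ => S θ) atTop (𝓝 a)) (hp : p ≠ 0) (hq : q ≠ 0) :
    Tendsto (fun m => kernel S m p q) (𝓝[>] 0) (𝓝 (kernel S 0 p q)) := by
  rcases lt_or_gt_of_ne hp with hp | hp <;> rcases lt_or_gt_of_ne hq with hq | hq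
  · simpa only [kernel_neg_neg] using tendsto_kernel_of_pos hS (neg_pos.2 hq) (neg_pos.2 hp)
  · simp only [← conj_kernel hS hlim _ q p]
    exact (Complex.continuous_conj.tendsto _).comp (tendsto_kernel_of_pos_of_neg hlim hq hp)
  · exact tendsto_kernel_of_pos_of_neg hlim hp hq
  · exact tendsto_kernel_of_pos hS hp hq

end KernelLimit

/-! ### Scaling -/

section Scaling

variable {l : ℝ}

theorem energy_mul (hl : 0 < l) (m p : ℝ) : energy (l * m) (l * p) = l * energy m p := by
  rw [energy, energy, mul_pow, mul_pow, ← mul_add, Real.sqrt_mul (sq_nonneg l), Real.sqrt_sq hl.le]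

theorem kernel_mul (hl : 0 < l) (S : ℂ → ℂ) {m : ℝ} (hm : m ≠ 0) (p q : ℝ) :
    kernel S (l * m) (l * p) (l * q) = kernel S m p q := by
  rw [kernel_of_ne_zero S hm, kernel_of_ne_zero S (mul_ne_zero hl.ne' hm), massiveKernel,
    massiveKernel, energy_mul hl, energy_mul hl]
  congr 3
  field_simp [hl.ne']

theorem integral_momentumMeasure (m : ℝ) (g : ℝ → ℂ) :
    ∫ q, g q ∂(momentumMeasure m) = ∫ q, (energy m q)⁻¹ • g q := by
  have henergy := (continuous_energy m).measurable
  refine (integral_withDensity_eq_integral_toReal_smul henergy.inv.ennreal_ofReal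
    (by simp) g).trans (integral_congr_ae (.of_forall fun q => ?_))
  exact congrArg (· • g q) (ENNReal.toReal_ofReal (inv_nonneg.2 (Real.sqrt_nonneg _)))

theorem massShell_rescale (hl : 0 < l) (ε m : ℝ) (f : 𝓢(Spacetime, ℂ)) (p : ℝ) :
    massShell ε m (rescale l f) p = massShell ε (l * m) f (l * p) := by
  have hintegrand (x : Spacetime) : rescale l f x *
      Complex.exp (ε * Complex.I * (energy m p * x 0 - p * x 1 : ℝ)) =
        ((l : ℂ) ^ 2)⁻¹ * (f (l⁻¹ • x) * Complex.exp (ε * Complex.I *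
          (energy (l * m) (l * p) * (l⁻¹ • x) 0 - l * p * (l⁻¹ • x) 1 : ℝ))) := by
    rw [rescale_apply hl, mul_assoc, energy_mul hl, PiLp.smul_apply, PiLp.smul_apply, smul_eq_mul,
      smul_eq_mul]
    congr 5
    field_simp [hl.ne']
  have hl_sq : (l : ℂ) ^ 2 ≠ 0 := pow_ne_zero 2 (Complex.ofReal_ne_zero.2 hl.ne')
  rw [massShell, massShell]
  simp only [hintegrand]
  rw [integral_const_mul, Measure.integral_comp_inv_smul volume (fun y : Spacetime => f y *
      Complex.exp (ε * Complex.I * (energy (l * m) (l * p) * y 0 - l * p * y 1 : ℝ))) l,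
    finrank_euclideanSpace_fin, abs_of_pos (by positivity), Complex.real_smul, Complex.ofReal_pow,
    inv_mul_cancel_left₀ hl_sq]

theorem createFun_comp_mul {s t : ℝ → ℝ → ℂ} {φ ψ : ℝ → ℂ} {n : ℕ} {Ψ Φ : (Fin n → ℝ) → ℂ}
    (hs : ∀ p q, s p q = t (l * p) (l * q)) (hφ : ∀ p, φ p = ψ (l * p))
    (hΨ : ∀ p, Ψ p = Φ fun i => l * p i) (p : Fin (n + 1) → ℝ) :
    createFun s φ Ψ p = createFun t ψ Φ fun i => l * p i := by
  simp only [createFun, insertFun, exchangeFactor, hs, hφ, hΨ]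
  rfl

theorem annihilateFun_comp_mul (hl : 0 < l) (m : ℝ) {φ ψ : ℝ → ℂ} {n : ℕ}
    {Ψ Φ : (Fin (n + 1) → ℝ) → ℂ} (hφ : ∀ p, φ p = ψ (l * p))
    (hΨ : ∀ p, Ψ p = Φ fun i => l * p i) (p : Fin n → ℝ) :
    annihilateFun (μ := momentumMeasure m) φ Ψ p =
      annihilateFun (μ := momentumMeasure (l * m)) ψ Φ fun i => l * p i := by
  have hcons (q : ℝ) : (fun i => l * (Fin.cons q p : Fin (n + 1) → ℝ) i) =
      (Fin.cons (l * q) fun i => l * p i : Fin (n + 1) → ℝ) := by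
    funext i
    cases i using Fin.cases <;> rfl
  have hintegrand (q : ℝ) : (energy m q)⁻¹ • (φ q * Ψ (Fin.cons q p)) =
      l • ((energy (l * m) (l * q))⁻¹ •
        (ψ (l * q) * Φ (Fin.cons (l * q) fun i => l * p i))) := by
    rw [hφ, hΨ, hcons, energy_mul hl, smul_smul, mul_inv, mul_inv_cancel_left₀ hl.ne']
  rw [annihilateFun, annihilateFun, integral_momentumMeasure, integral_momentumMeasure]
  simp only [hintegrand]
  rw [integral_smul, Measure.integral_comp_mul_left (fun q => (energy (l * m) q)⁻¹ •
      (ψ q * Φ (Fin.cons q fun i => l * p i))) l,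
    smul_smul, abs_of_pos (inv_pos.2 hl), mul_inv_cancel₀ hl.ne', one_smul]

theorem stateFun_map_rescale (hl : 0 < l) (S : ℂ → ℂ) {m : ℝ} (hm : m ≠ 0)
    (fs : List 𝓢(Spacetime, ℂ)) (n : ℕ) (p : Fin n → ℝ) :
    stateFun S m (fs.map (rescale l)) n p = stateFun S (l * m) fs n fun i => l * p i := by
  induction fs generalizing n with
  | nil => rfl
  | cons f fs ih =>
    change fieldFun S m (rescale l f) (stateFun S m (fs.map (rescale l))) n p =
      fieldFun S (l * m) f (stateFun S (l * m) fs) n _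
    rw [fieldFun, fieldFun, annihilateFun_comp_mul hl m (massShell_rescale hl _ m f) (ih (n + 1))]
    congr 1
    cases n with
    | zero => rfl
    | succ k =>
      exact createFun_comp_mul (fun p q => (kernel_mul hl S hm p q).symm)
        (massShell_rescale hl _ m f) (ih k) p

end Scaling

/-! ### Bounds uniform in the mass -/

section SchwartzBounds

variable {E F : Type*} [NormedAddCommGroup E] [NormedSpace ℝ E] [NormedAddCommGroup F]
  [NormedSpace ℝ F]

theorem exists_norm_apply_le_mul_norm (g : 𝓢(E, F)) (hg : g 0 = 0) :
    ∃ B, 0 ≤ B ∧ ∀ x, ‖g x‖ ≤ B * ‖x‖ := by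
  obtain ⟨B, hB0, hB⟩ := g.decay 0 1
  refine ⟨B, hB0.le, fun x => ?_⟩
  have h := convex_univ.norm_image_sub_le_of_norm_fderiv_le (𝕜 := ℝ)
    (fun x _ => g.differentiableAt) (fun x _ => by simpa [norm_iteratedFDeriv_one] using hB x)
    (Set.mem_univ (0 : E)) (Set.mem_univ x)
  rwa [hg, sub_zero, sub_zero] at h

theorem exists_norm_apply_mul_one_add_norm_sq_le (g : 𝓢(E, F)) {c : ℝ} (hc : 0 ≤ c) :
    ∃ A, 0 ≤ A ∧ ∀ x, ‖g x‖ * (1 + c * ‖x‖ ^ 2) ≤ A := by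
  obtain ⟨A, hA0, hA⟩ := g.decay 0 0
  obtain ⟨A', hA0', hA'⟩ := g.decay 2 0
  simp only [norm_iteratedFDeriv_zero, pow_zero, one_mul] at hA hA'
  refine ⟨A + c * A', by positivity, fun x => ?_⟩
  calc ‖g x‖ * (1 + c * ‖x‖ ^ 2) = ‖g x‖ + c * (‖x‖ ^ 2 * ‖g x‖) := by ring
    _ ≤ A + c * A' := add_le_add (hA x) (mul_le_mul_of_nonneg_left (hA' x) hc)

end SchwartzBounds

/-- The function `(ω_p^m / (1 + p²))^{1/2}`. It dominates every `f^{m±}` with `f^{0±}(0) = 0` up to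
a constant independent of `m`, and is square integrable for `dp / ω_p^m` with norm at most `π^{1/2}`
for every `m`. -/
def weight (m p : ℝ) : ℝ := √(energy m p * (1 + p ^ 2)⁻¹)

theorem energy_nonneg (m p : ℝ) : 0 ≤ energy m p := Real.sqrt_nonneg _

theorem weight_nonneg (m p : ℝ) : 0 ≤ weight m p := Real.sqrt_nonneg _

theorem prod_weight_nonneg {n : ℕ} (m : ℝ) (p : Fin n → ℝ) : 0 ≤ ∏ i, weight m (p i) :=
  Finset.prod_nonneg fun i _ => weight_nonneg m (p i)

theorem weight_mul_self (m p : ℝ) : weight m p * weight m p = energy m p * (1 + p ^ 2)⁻¹ :=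
  Real.mul_self_sqrt (mul_nonneg (energy_nonneg m p) (by positivity))

theorem weight_le_weight {m m' : ℝ} (hm : 0 ≤ m) (h : m ≤ m') (p : ℝ) :
    weight m p ≤ weight m' p := by
  unfold weight energy
  gcongr

section MassShell

variable {ε : ℝ}

theorem norm_shellPoint_sq (hε : ε ^ 2 = 1) (m p : ℝ) :
    4 * Real.pi ^ 2 * ‖shellPoint ε m p‖ ^ 2 = energy m p ^ 2 + p ^ 2 := by
  simp only [EuclideanSpace.norm_sq_eq, shellPoint, Fin.sum_univ_two, Real.norm_eq_abs, sq_abs,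
    Matrix.cons_val_zero, Matrix.cons_val_one, neg_sq, div_pow, mul_pow, hε]
  field_simp
  ring

theorem norm_shellPoint_le (hε : ε ^ 2 = 1) (m p : ℝ) : ‖shellPoint ε m p‖ ≤ energy m p := by
  have hp : p ^ 2 ≤ energy m p ^ 2 := by
    rw [energy, Real.sq_sqrt (by positivity)]
    exact le_add_of_nonneg_right (sq_nonneg m)
  have hpi : (2 : ℝ) ≤ 4 * Real.pi ^ 2 := by nlinarith [Real.pi_gt_three]
  refine le_of_sq_le_sq ?_ (energy_nonneg m p)
  nlinarith [norm_shellPoint_sq hε m p,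
    mul_le_mul_of_nonneg_right hpi (sq_nonneg ‖shellPoint ε m p‖)]

theorem norm_massShell_le_norm_fourier (ε m : ℝ) (f : 𝓢(Spacetime, ℂ)) (p : ℝ) :
    ‖massShell ε m f p‖ ≤ ‖𝓕 f (shellPoint ε m p)‖ := by
  have hpi : ‖(1 / (2 * Real.pi) : ℂ)‖ ≤ 1 := by
    rw [norm_div, norm_one, norm_mul, Complex.norm_ofNat, Complex.norm_real,
      Real.norm_of_nonneg Real.pi_pos.le, div_le_one (by positivity)]
    linarith [Real.pi_gt_three]
  rw [massShell_eq, norm_mul]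
  exact mul_le_of_le_one_left (norm_nonneg _) hpi

theorem massShell_zero_zero_eq_zero_iff {f : 𝓢(Spacetime, ℂ)} :
    massShell ε 0 f 0 = 0 ↔ ∫ x, f x = 0 := by
  have hpi : (Real.pi : ℂ) ≠ 0 := Complex.ofReal_ne_zero.2 Real.pi_ne_zero
  simp [massShell, energy, hpi]

/-- The geometric mean of two bounds on `𝓕 f`: its decay at infinity, and its Lipschitz bound at the
zero `0`, at a point of norm at most `ω_p^m`. -/
theorem exists_norm_massShell_le (hε : ε ^ 2 = 1) {f : 𝓢(Spacetime, ℂ)} (hf : ∫ x, f x = 0) :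
    ∃ C, 0 ≤ C ∧ ∀ m p, ‖massShell ε m f p‖ ≤ C * weight m p := by
  have hzero : 𝓕 f 0 = 0 := by simp [SchwartzMap.fourier_coe, Real.fourier_eq, hf]
  obtain ⟨B, hB0, hB⟩ := exists_norm_apply_le_mul_norm (𝓕 f) hzero
  obtain ⟨A, hA0, hA⟩ := exists_norm_apply_mul_one_add_norm_sq_le (𝓕 f)
    (c := 4 * Real.pi ^ 2) (by positivity)
  refine ⟨√(B * A), Real.sqrt_nonneg _, fun m p => ?_⟩
  refine (norm_massShell_le_norm_fourier ε m f p).trans ?_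
  set x := shellPoint ε m p
  have hlipschitz : ‖𝓕 f x‖ ≤ B * energy m p :=
    (hB x).trans (mul_le_mul_of_nonneg_left (norm_shellPoint_le hε m p) hB0)
  have hdecay : ‖𝓕 f x‖ ≤ A * (1 + p ^ 2)⁻¹ := by
    rw [← div_eq_mul_inv, le_div_iff₀ (by positivity)]
    refine le_trans (mul_le_mul_of_nonneg_left ?_ (norm_nonneg _)) (hA x)
    rw [norm_shellPoint_sq hε]
    linarith [sq_nonneg (energy m p)]
  rw [weight, ← Real.sqrt_mul (mul_nonneg hB0 hA0)]
  refine Real.le_sqrt_of_sq_le ?_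
  calc ‖𝓕 f x‖ ^ 2 = ‖𝓕 f x‖ * ‖𝓕 f x‖ := sq _
    _ ≤ B * energy m p * (A * (1 + p ^ 2)⁻¹) :=
      mul_le_mul hlipschitz hdecay (norm_nonneg _) (mul_nonneg hB0 (energy_nonneg m p))
    _ = B * A * (energy m p * (1 + p ^ 2)⁻¹) := by ring

end MassShell

section OperatorBounds

variable {φ : ℝ → ℂ} {n : ℕ} {C K : ℝ}

theorem norm_createFun_le {s : ℝ → ℝ → ℂ} (hs : ∀ p q, s p q * conj (s p q) = 1)
    {Ψ : (Fin n → ℝ) → ℂ} {w : ℝ → ℝ} (hφ : ∀ p, ‖φ p‖ ≤ C * w p)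
    (hΨ : ∀ p, ‖Ψ p‖ ≤ K * ∏ i, w (p i)) (p : Fin (n + 1) → ℝ) :
    ‖createFun s φ Ψ p‖ ≤ (√(n + 1))⁻¹ * ((n + 1) * (C * K)) * ∏ i, w (p i) := by
  have hinsert (k : Fin (n + 1)) : ‖insertFun s φ Ψ k p‖ ≤ C * K * ∏ i, w (p i) :=
    calc ‖insertFun s φ Ψ k p‖ = ‖φ (p k)‖ * ‖Ψ (k.removeNth p)‖ := by
          rw [insertFun, norm_mul, norm_exchangeFactor hs, one_mul, norm_mul]
      _ ≤ C * w (p k) * (K * ∏ i, w (p (k.succAbove i))) :=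
          mul_le_mul (hφ _) (hΨ _) (norm_nonneg _) ((norm_nonneg _).trans (hφ _))
      _ = C * K * ∏ i, w (p i) := by
          rw [Fin.prod_univ_succAbove (fun i => w (p i)) k]
          ring
  rw [createFun, norm_mul, norm_inv, Complex.norm_real, Real.norm_of_nonneg (Real.sqrt_nonneg _),
    mul_assoc]
  refine mul_le_mul_of_nonneg_left ?_ (inv_nonneg.2 (Real.sqrt_nonneg _))
  refine (norm_sum_le_of_le _ fun k _ => hinsert k).trans_eq ?_
  rw [Finset.sum_const, Finset.card_univ, Fintype.card_fin, nsmul_eq_mul]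
  push_cast
  ring

variable {m : ℝ} {Ψ : (Fin (n + 1) → ℝ) → ℂ} (hφ : ∀ p, ‖φ p‖ ≤ C * weight m p)
  (hΨ : ∀ p, ‖Ψ p‖ ≤ K * ∏ i, weight m (p i)) (hC : 0 ≤ C) (hK : 0 ≤ K)
include hφ hΨ hC hK

/-- The square of `weight m q` cancels the density of `momentumMeasure m`. -/
theorem norm_annihilateFun_integrand_le (p : Fin n → ℝ) (q : ℝ) :
    ‖(energy m q)⁻¹ • (φ q * Ψ (Fin.cons q p))‖ ≤
      C * K * (∏ i, weight m (p i)) * (1 + q ^ 2)⁻¹ := by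
  have henergy := energy_nonneg m q
  have hprod := prod_weight_nonneg m p
  have hcons := hΨ (Fin.cons q p)
  simp only [Fin.prod_univ_succ, Fin.cons_zero, Fin.cons_succ] at hcons
  rw [norm_smul, norm_mul, Real.norm_of_nonneg (inv_nonneg.2 henergy)]
  calc (energy m q)⁻¹ * (‖φ q‖ * ‖Ψ (Fin.cons q p)‖)
      ≤ (energy m q)⁻¹ * (C * weight m q * (K * (weight m q * ∏ i, weight m (p i)))) :=
        mul_le_mul_of_nonneg_left (mul_le_mul (hφ q) hcons (norm_nonneg _)
          (mul_nonneg hC (weight_nonneg m q))) (inv_nonneg.2 henergy)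
    _ = (energy m q)⁻¹ * (C * K * (∏ i, weight m (p i)) * (weight m q * weight m q)) := by ring
    _ = (energy m q)⁻¹ * energy m q * (C * K * (∏ i, weight m (p i)) * (1 + q ^ 2)⁻¹) := by
        rw [weight_mul_self]
        ring
    _ ≤ C * K * (∏ i, weight m (p i)) * (1 + q ^ 2)⁻¹ :=
        mul_le_of_le_one_left (by positivity) inv_mul_le_one

theorem norm_annihilateFun_le (p : Fin n → ℝ) :
    ‖annihilateFun (μ := momentumMeasure m) φ Ψ p‖ ≤
      √(n + 1) * (C * K * Real.pi) * ∏ i, weight m (p i) := by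
  rw [annihilateFun, integral_momentumMeasure, norm_mul, Complex.norm_real,
    Real.norm_of_nonneg (Real.sqrt_nonneg _), mul_assoc]
  refine mul_le_mul_of_nonneg_left ?_ (Real.sqrt_nonneg _)
  refine (norm_integral_le_of_norm_le (integrable_inv_one_add_sq.const_mul _)
    (.of_forall (norm_annihilateFun_integrand_le hφ hΨ hC hK p))).trans_eq ?_
  rw [integral_const_mul, integral_univ_inv_one_add_sq]
  ring

end OperatorBounds

theorem exists_norm_stateFun_le {S : ℂ → ℂ}
    (hs : ∀ m p q, kernel S m p q * conj (kernel S m p q) = 1) {fs : List 𝓢(Spacetime, ℂ)}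
    (hfs : ∀ f ∈ fs, ∫ x, f x = 0) (n : ℕ) :
    ∃ K, 0 ≤ K ∧ ∀ m p, ‖stateFun S m fs n p‖ ≤ K * ∏ i, weight m (p i) := by
  induction fs generalizing n with
  | nil =>
    refine ⟨1, zero_le_one, fun m p => ?_⟩
    change ‖vacuumFun n p‖ ≤ _
    cases n with
    | zero => simp [vacuumFun]
    | succ k => simpa [vacuumFun] using prod_weight_nonneg m p
  | cons f fs ih =>
    obtain ⟨hf, hfs⟩ := List.forall_mem_cons.1 hfs
    obtain ⟨C, hC0, hC⟩ := exists_norm_massShell_le (ε := 1) (by norm_num) hf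
    obtain ⟨D, hD0, hD⟩ := exists_norm_massShell_le (ε := -1) (by norm_num) hf
    obtain ⟨K, hK0, hK⟩ := ih hfs (n + 1)
    obtain ⟨K', hK0', hcreation⟩ : ∃ K', 0 ≤ K' ∧ ∀ m p,
        ‖creationFun (kernel S m) (massShell 1 m f) (stateFun S m fs) n p‖ ≤
          K' * ∏ i, weight m (p i) := by
      cases n with
      | zero => exact ⟨0, le_rfl, fun m p => by simp [creationFun]⟩
      | succ k =>
        obtain ⟨K₁, hK₁0, hK₁⟩ := ih hfs k
        exact ⟨_, by positivity, fun m => norm_createFun_le (hs m) (hC m) (hK₁ m)⟩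
    refine ⟨K' + √(n + 1) * (D * K * Real.pi), by positivity, fun m p => ?_⟩
    rw [add_mul]
    exact (norm_add_le _ _).trans
      (add_le_add (hcreation m p) (norm_annihilateFun_le (hD m) (hK m) hD0 hK0 p))

/-! ### The massless limit of the vacuum expectation values -/

section Measurability

variable {φ : ℝ → ℂ} {n : ℕ}

theorem measurable_createFun {s : ℝ → ℝ → ℂ} (hs : Measurable (Function.uncurry s))
    (hφ : Measurable φ) {Ψ : (Fin n → ℝ) → ℂ} (hΨ : Measurable Ψ) :
    Measurable (createFun s φ Ψ) := by
  refine (Finset.measurable_fun_sum _ fun k _ => ?_).const_mul _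
  exact (measurable_exchangeFactor hs k).mul ((hφ.comp (measurable_pi_apply k)).mul
    (hΨ.comp (measurable_pi_lambda _ fun i => measurable_pi_apply _)))

theorem measurable_cons :
    Measurable fun z : (Fin n → ℝ) × ℝ => (Fin.cons z.2 z.1 : Fin (n + 1) → ℝ) := by
  refine measurable_pi_lambda _ fun i => ?_
  cases i using Fin.cases with
  | zero => exact measurable_snd
  | succ i => exact (measurable_pi_apply i).comp measurable_fst

theorem measurable_annihilateFun {μ : Measure ℝ} [SigmaFinite μ] (hφ : Measurable φ)
    {Ψ : (Fin (n + 1) → ℝ) → ℂ} (hΨ : Measurable Ψ) :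
    Measurable (annihilateFun (μ := μ) φ Ψ) := by
  have h : Measurable fun z : (Fin n → ℝ) × ℝ => φ z.2 * Ψ (Fin.cons z.2 z.1) :=
    (hφ.comp measurable_snd).mul (hΨ.comp measurable_cons)
  exact h.stronglyMeasurable.integral_prod_right'.measurable.const_mul _

theorem measurable_stateFun {S : ℂ → ℂ} {m : ℝ} (hs : Measurable (Function.uncurry (kernel S m)))
    (fs : List 𝓢(Spacetime, ℂ)) (n : ℕ) : Measurable (stateFun S m fs n) := by
  induction fs generalizing n with
  | nil => exact measurable_const
  | cons f fs ih =>
    have hshell (ε : ℝ) := (continuous_massShell ε m f).measurable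
    refine Measurable.add ?_ (measurable_annihilateFun (hshell _) (ih (n + 1)))
    cases n with
    | zero => exact measurable_const
    | succ k => exact measurable_createFun hs (hshell _) (ih k)

end Measurability

theorem tendsto_massShell (ε : ℝ) (f : 𝓢(Spacetime, ℂ)) (p : ℝ) :
    Tendsto (fun m => massShell ε m f p) (𝓝[>] 0) (𝓝 (massShell ε 0 f p)) := by
  have hcont : Continuous fun m => massShell ε m f p := by
    simp only [massShell_eq]
    refine continuous_const.mul ((𝓕 f).continuous.comp ?_)
    unfold shellPoint energy
    fun_prop
  exact (hcont.tendsto 0).mono_left nhdsWithin_le_nhds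

theorem tendsto_createFun {ι : Type*} {L : Filter ι} {s : ι → ℝ → ℝ → ℂ} {s₀ : ℝ → ℝ → ℂ}
    {φ : ι → ℝ → ℂ} {φ₀ : ℝ → ℂ} {n : ℕ} {F : ι → (Fin n → ℝ) → ℂ} {F₀ : (Fin n → ℝ) → ℂ}
    {p : Fin (n + 1) → ℝ}
    (hs : ∀ i j, Tendsto (fun a => s a (p i) (p j)) L (𝓝 (s₀ (p i) (p j))))
    (hφ : ∀ i, Tendsto (fun a => φ a (p i)) L (𝓝 (φ₀ (p i))))
    (hF : ∀ k : Fin (n + 1),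
      Tendsto (fun a => F a (k.removeNth p)) L (𝓝 (F₀ (k.removeNth p)))) :
    Tendsto (fun a => createFun (s a) (φ a) (F a) p) L (𝓝 (createFun s₀ φ₀ F₀ p)) :=
  (tendsto_finsetSum _ fun k _ => (tendsto_finsetProd _ fun l _ => hs k l).mul
    ((hφ k).mul (hF k))).const_mul _

theorem tendsto_annihilateFun {φ : ℝ → ℝ → ℂ} (hφ_meas : ∀ m, Measurable (φ m)) {C : ℝ}
    (hC : 0 ≤ C) (hφ_le : ∀ m p, ‖φ m p‖ ≤ C * weight m p)
    (hφ : ∀ p, Tendsto (fun m => φ m p) (𝓝[>] 0) (𝓝 (φ 0 p))) {n : ℕ}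
    {F : ℝ → (Fin (n + 1) → ℝ) → ℂ} (hF_meas : ∀ m, Measurable (F m)) {K : ℝ} (hK : 0 ≤ K)
    (hF_le : ∀ m p, ‖F m p‖ ≤ K * ∏ i, weight m (p i))
    (hF : ∀ p : Fin (n + 1) → ℝ, (∀ i, p i ≠ 0) → Tendsto (fun m => F m p) (𝓝[>] 0) (𝓝 (F 0 p)))
    {p : Fin n → ℝ} (hp : ∀ i, p i ≠ 0) :
    Tendsto (fun m => annihilateFun (μ := momentumMeasure m) (φ m) (F m) p) (𝓝[>] 0)
      (𝓝 (annihilateFun (μ := momentumMeasure 0) (φ 0) (F 0) p)) := by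
  simp only [annihilateFun, integral_momentumMeasure]
  refine Tendsto.const_mul _ (tendsto_integral_filter_of_dominated_convergence
    (fun q => C * K * (∏ i, weight 1 (p i)) * (1 + q ^ 2)⁻¹)
    (.of_forall fun m => Measurable.aestronglyMeasurable ?_) ?_
    (integrable_inv_one_add_sq.const_mul _) ?_)
  · exact (continuous_energy m).measurable.inv.smul ((hφ_meas m).mul
      ((hF_meas m).comp (measurable_cons.comp measurable_prodMk_left)))
  · filter_upwards [Ioc_mem_nhdsGT one_pos] with m hm
    refine .of_forall fun q =>
      (norm_annihilateFun_integrand_le (hφ_le m) (hF_le m) hC hK p q).trans ?_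
    gcongr with i
    · exact fun i _ => weight_nonneg m _
    · exact weight_le_weight hm.1.le hm.2 _
  · filter_upwards [compl_mem_ae_iff.2 (measure_singleton (0 : ℝ))] with q hq
    have henergy : Tendsto (fun m => (energy m q)⁻¹) (𝓝[>] 0) (𝓝 (energy 0 q)⁻¹) := by
      refine (((continuous_energy_mass q).tendsto 0).mono_left nhdsWithin_le_nhds).inv₀ ?_
      rw [energy_zero]
      exact abs_ne_zero.2 hq
    exact henergy.smul ((hφ q).mul (hF _ (Fin.cases hq hp)))

section Limit

variable {S : ℂ → ℂ} (hS : IsScatteringFunction S)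
  (hlim : ∃ a : ℂ, Tendsto (fun θ : ℝ => S θ) atTop (𝓝 a))
include hS hlim

theorem tendsto_stateFun {fs : List 𝓢(Spacetime, ℂ)} (hfs : ∀ f ∈ fs, ∫ x, f x = 0) {n : ℕ}
    {p : Fin n → ℝ} (hp : ∀ i, p i ≠ 0) :
    Tendsto (fun m => stateFun S m fs n p) (𝓝[>] 0) (𝓝 (stateFun S 0 fs n p)) := by
  induction fs generalizing n with
  | nil => exact tendsto_const_nhds
  | cons f fs ih =>
    obtain ⟨hf, hfs⟩ := List.forall_mem_cons.1 hfs
    obtain ⟨C, hC0, hC⟩ := exists_norm_massShell_le (ε := -1) (by norm_num) hf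
    obtain ⟨K, hK0, hK⟩ := exists_norm_stateFun_le (kernel_mul_conj hS hlim) hfs (n + 1)
    refine Tendsto.add ?_ (tendsto_annihilateFun (fun m => (continuous_massShell _ m f).measurable)
      hC0 hC (tendsto_massShell _ f)
      (fun m => measurable_stateFun (measurable_kernel hS m) fs (n + 1)) hK0 hK
      (fun _ => ih hfs) hp)
    cases n with
    | zero => exact tendsto_const_nhds
    | succ k =>
      exact tendsto_createFun (fun i j => tendsto_kernel hS hlim (hp i) (hp j))
        (fun i => tendsto_massShell 1 f (p i)) (fun _ => ih hfs fun _ => hp _)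

variable {n : ℕ} {f : Fin n → 𝓢(Spacetime, ℂ)}

theorem vacuumExpectation_field_rescale {m : ℝ} (hm : 0 < m) {l : ℝ} (hl : 0 < l) :
    vacuumExpectation (fun j => field S m (rescale l (f j))) =
      stateFun S (l * m) (List.ofFn f) 0 ![] := by
  have hmap : (List.ofFn fun j => rescale l (f j)) = (List.ofFn f).map (rescale l) := by
    rw [List.map_ofFn]
    rfl
  rw [vacuumExpectation_field (isExchangeKernel_kernel hS hlim m)
    (fun j => memLp_massShell_of_pos (by norm_num) hm _)
    (fun j => memLp_massShell_of_pos (by norm_num) hm _), hmap, stateFun_map_rescale hl S hm.ne']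
  exact congrArg _ (Subsingleton.elim _ _)

theorem vacuumExpectation_field_zero_mass (hf : ∀ j, ∫ x, f j x = 0) :
    vacuumExpectation (fun j => field S 0 (f j)) = stateFun S 0 (List.ofFn f) 0 ![] :=
  vacuumExpectation_field (isExchangeKernel_kernel hS hlim 0)
    (fun j => memLp_massShell_zero (by norm_num) _ (massShell_zero_zero_eq_zero_iff.2 (hf j)))
    (fun j => memLp_massShell_zero (by norm_num) _ (massShell_zero_zero_eq_zero_iff.2 (hf j)))

theorem tendsto_nPoint {m : ℝ} (hm : 0 < m) (hf : ∀ j, ∫ x, f j x = 0) :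
    Tendsto (fun l : ℝ => nPoint S m l f) (𝓝[>] 0) (𝓝 (nPoint S 0 1 f)) := by
  have hmass : Tendsto (fun l : ℝ => l * m) (𝓝[>] 0) (𝓝[>] 0) := by
    refine tendsto_nhdsWithin_iff.2 ⟨?_, ?_⟩
    · simpa using ((continuous_mul_const m).tendsto 0).mono_left nhdsWithin_le_nhds
    · filter_upwards [self_mem_nhdsWithin] with l hl using mul_pos hl hm
  have hstate := tendsto_stateFun hS hlim (List.forall_mem_ofFn_iff.2 hf) (p := ![])
    fun i => i.elim0
  simp only [nPoint, rescale_one, vacuumExpectation_field_zero_mass hS hlim hf]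
  refine (hstate.comp hmass).congr' ?_
  filter_upwards [self_mem_nhdsWithin] with l hl
  exact (vacuumExpectation_field_rescale hS hlim hm hl).symm

theorem vacuumExpectation_reflectedOperator_field (m : ℝ) {l : ℝ} (hl : 0 < l)
    (f : Fin n → 𝓢(Spacetime, ℂ)) :
    vacuumExpectation (fun j => reflectedOperator (kernel_mul_conj hS hlim m)
      (field S m (reflect (rescale l (f j))))) = conj (nPoint S m l fun j => reflect (f j)) := by
  simp only [vacuumExpectation_reflectedOperator, reflect_rescale hl]
  rfl

theorem tendsto_vacuumExpectation_reflectedOperator {m : ℝ} (hm : 0 < m)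
    (hf : ∀ j, ∫ x, f j x = 0) :
    Tendsto (fun l : ℝ => vacuumExpectation fun j => reflectedOperator
        (kernel_mul_conj hS hlim m) (field S m (reflect (rescale l (f j))))) (𝓝[>] 0)
      (𝓝 (vacuumExpectation fun j => reflectedOperator
        (kernel_mul_conj hS hlim 0) (field S 0 (reflect (rescale 1 (f j)))))) := by
  rw [vacuumExpectation_reflectedOperator_field hS hlim 0 one_pos f]
  have hreflect (j : Fin n) : ∫ x, reflect (f j) x = 0 := by
    rw [integral_reflect, hf, map_zero]
  refine ((Complex.continuous_conj.tendsto _).comp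
    (tendsto_nPoint hS hlim hm hreflect)).congr' ?_
  filter_upwards [self_mem_nhdsWithin] with l hl
  exact (vacuumExpectation_reflectedOperator_field hS hlim m hl f).symm

end Limit

end

end FactorizingModel

theorem mainTheorem7_general (m : ℝ) (hm : 0 < m) (S : ℂ → ℂ)
    (hS : FactorizingModel.IsScatteringFunction S)
    (hlim : ∃ a : ℂ, Tendsto (fun θ : ℝ => S θ) atTop (𝓝 a))
    (n : ℕ) (f : Fin n → 𝓢(FactorizingModel.Spacetime, ℂ)) (hf : ∀ j, ∫ x, f j x = 0) :
    Tendsto (fun l : ℝ => FactorizingModel.nPoint S m l f) (𝓝[>] 0)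
        (𝓝 (FactorizingModel.nPoint S 0 1 f)) ∧
      Tendsto (fun l : ℝ => FactorizingModel.vacuumExpectation fun j =>
          FactorizingModel.reflectedOperator (FactorizingModel.kernel_mul_conj hS hlim m)
            (FactorizingModel.field S m (FactorizingModel.reflect
              (FactorizingModel.rescale l (f j))))) (𝓝[>] 0)
        (𝓝 (FactorizingModel.vacuumExpectation fun j =>
          FactorizingModel.reflectedOperator (FactorizingModel.kernel_mul_conj hS hlim 0)
            (FactorizingModel.field S 0 (FactorizingModel.reflect
              (FactorizingModel.rescale 1 (f j)))))) :=
  ⟨FactorizingModel.tendsto_nPoint hS hlim hm hf,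
    FactorizingModel.tendsto_vacuumExpectation_reflectedOperator hS hlim hm hf⟩

theorem mainTheorem7 (m : ℝ) (hm : 0 < m) (S : ℂ → ℂ)
    (hS : FactorizingModel.IsScatteringFunctionWithLimit S)
    (n : ℕ) (f : Fin n → 𝓢(FactorizingModel.Spacetime, ℂ))
    (hf : ∀ j, FactorizingModel.massShell 1 0 (f j) 0 = 0 ∧
      FactorizingModel.massShell (-1) 0 (f j) 0 = 0) :
    Tendsto (fun l : ℝ => FactorizingModel.nPoint S m l f) (𝓝[>] 0)
        (𝓝 (FactorizingModel.nPoint S 0 1 f)) ∧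
      Tendsto (fun l : ℝ => FactorizingModel.reflectedNPoint hS m l f) (𝓝[>] 0)
        (𝓝 (FactorizingModel.reflectedNPoint hS 0 1 f)) :=
  mainTheorem7_general m hm S hS.toIsScatteringFunction hS.limit_atTop n f fun j =>
    FactorizingModel.massShell_zero_zero_eq_zero_iff.1 (hf j).1
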